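/- All matroids are finite. Let $M$ be a matroid on $E$ with rank function $\rho_M$. \emph{Parameters.} $M$ is called an $(n,k,d,r,\delta)$-matroid if $|E|=n$, $\rho_M(E)=k$, $d$ is the minimum size of a circuit of the dual matroid $M^*$, and every element of $E$ lies in a set $S\subseteq E$ with $|S|\le r+\delta-1$ such that every circuit of $(M|S)^*$ has at least $\delta$ elements. \emph{The class $\mathcal A$.} Let $F_1,\dots,F_m$ be subsets of a finite set $E$, $k$ a positive integer and $\rho:\{F_1,\dots,F_m\}\to\mathbb Z$. Write $F_I=\bigcup_{i\in I}F_i$ for $I\subseteq[m]$ and $\eta(F_i)=|F_i|-\rho(F_i)$, and suppose that (i) $0<\rho(F_i)<|F_i|$ for all $i\in[m]$; (ii) $F_{[m]}=E$; (iii) $k\le |F_{[m]}|-\sum_{i\in[m]}\eta(F_i)$; (iv) $|F_{[m]\setminus\{j\}}\cap F_j|<\rho(F_j)$ for all $j\in[m]$. Let $\mathcal Z_{<k}=\{F_J: J\subseteq[m],\ |F_I|-\sum_{i\in I}\eta(F_i)<k\text{ for all }I\subseteq J\}$. Then $M(F_1,\dots,F_m;k;\rho)$ denotes the matroid on $E$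 whose set of cyclic flats (flats that are unions of circuits) is $\mathcal Z_{<k}\cup\{E\}$, in which each $F_J\in\mathcal Z_{<k}$ has rank $|F_J|-\sum_{i\in J}\eta(F_i)$ and $E$ has rank $k$. Let $\mathcal A$ be the class of all matroids $M(F_1,\dots,F_m;k;\rho)$ arising in this way. \emph{The bound $d_b$.} For integers $n,k,r,\delta$ put $$b=\Big\lceil\tfrac{n}{r+\delta-1}\Big\rceil(r+\delta-1)-n,\quad m=\Big\lceil\tfrac{n}{r+\delta-1}\Big\rceil-1,\quad q=\Big\lfloor\tfrac{r+\delta-1-b}{m}\Big\rfloor,\quad v=r+\delta-1-b-qm,$$ and define $d_b=d_b(n,k,r,\delta)$ by $$d_b=\begin{cases} n-k+1-\lceil k/r\rceil(\delta-1) & \text{if } \delta-1\le(\lceil k/r\rceil-1)\,q+\min\{v,\lceil k/r\rceil-1\},\\ n-k+1-(\lceil k/r\rceil-1)(q+\delta-1)-\min\{v,\lceil k/r\rceil-1\} & \text{otherwise.}\end{cases}$$ \textbf{Theorem.} Let $n,k,r,\delta$ be integers with $0<r<k$ and $\delta\ge2$ such that $\mathcal A$ contains no $(n,k,d',r,\delta)$-matroid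 with $d'=n-k+1-(\lceil k/r\rceil-1)(\delta-1)$. Then every $(n,k,d,r,\delta)$-matroid in $\mathcal A$ satisfies $d\le d_b(n,k,r,\delta)$. Moreover the bound is tight within $\mathcal A$: if $k\le n-\lceil k/r\rceil(\delta-1)$, then $\mathcal A$ contains an $(n,k,d_b,r,\delta)$-matroid. -/

import Mathlib

open scoped Matroid

universe u

/-- The integer-valued rank of a set in a (finite) matroid. -/
noncomputable def rankZ {α : Type*} (M : Matroid α) (X : Set α) : ℤ :=
  ((M.eRk X).toNat : ℤ)

/-- `X` is a cyclic set: a union of circuits of `M`. -/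
def IsCyclicSet {α : Type*} (M : Matroid α) (X : Set α) : Prop :=
  ∃ 𝒞 : Set (Set α), (∀ C ∈ 𝒞, M.IsCircuit C) ∧ ⋃₀ 𝒞 = X

/-- `X` is a cyclic flat: a flat that is a union of circuits. -/
def IsCyclicFlat {α : Type*} (M : Matroid α) (X : Set α) : Prop :=
  M.IsFlat X ∧ IsCyclicSet M X

/-- `S` is an `(r, δ)`-locality set of `M`: `|S| ≤ r + δ - 1`, and every circuit of the dual
of the restriction `M|S` has at least `δ` elements. -/
def IsLocalitySet {α : Type*} (M : Matroid α) (r δ : ℤ) (S : Set α) : Prop :=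
  S ⊆ M.E ∧ (S.ncard : ℤ) ≤ r + δ - 1 ∧
    ∀ X : Set α, (M ↾ S)✶.IsCircuit X → δ ≤ (X.ncard : ℤ)

/-- `M` is an `(n, k, d, r, δ)`-matroid: a finite matroid with `n` elements and rank `k`, in which
the minimum size of a circuit of the dual matroid is `d`, and in which
every element lies in some `(r, δ)`-locality set. -/
structure IsParamMatroid {α : Type*} (M : Matroid α) (n k d r δ : ℤ) : Prop where
  finite : M.E.Finite
  card_eq : (M.E.ncard : ℤ) = n
  rank_eq : rankZ M M.E = k
  dist : IsLeast {t : ℤ | ∃ X : Set α, M✶.IsCircuit X ∧ t = (X.ncard : ℤ)} d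
  locality : ∀ j ∈ M.E, ∃ S : Set α, j ∈ S ∧ IsLocalitySet M r δ S

/-- The union `F_I` of the sets `F i`, `i ∈ I`. -/
def atomUnion {α : Type*} {m : ℕ} (F : Fin m → Set α) (I : Finset (Fin m)) : Set α :=
  ⋃ i ∈ I, F i

/-- The nullity `η(F_i) = |F_i| - ρ(F_i)`. -/
noncomputable def atomNullity {α : Type*} {m : ℕ} (F : Fin m → Set α) (ρ : Fin m → ℤ)
    (i : Fin m) : ℤ :=
  ((F i).ncard : ℤ) - ρ i

/-- The value `|F_I| - ∑_{i ∈ I} η(F_i)`. -/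
noncomputable def unionRank {α : Type*} {m : ℕ} (F : Fin m → Set α) (ρ : Fin m → ℤ)
    (I : Finset (Fin m)) : ℤ :=
  ((atomUnion F I).ncard : ℤ) - ∑ i ∈ I, atomNullity F ρ i

/-- The conditions on `F_1, …, F_m`, `k`, `ρ` over a finite set `E`.
The function `ρ` is indexed by `i` rather than by the set `F i`; this is the same because `pos_lt`
and `inter_lt` force the sets `F i` to be distinct. -/
structure IsAtomSystem {α : Type*} {m : ℕ} (E : Set α) (F : Fin m → Set α) (k : ℤ)
    (ρ : Fin m → ℤ) : Prop where
  finite : E.Finite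
  k_pos : 0 < k
  pos_lt : ∀ i, 0 < ρ i ∧ ρ i < ((F i).ncard : ℤ)
  union_eq : atomUnion F Finset.univ = E
  k_le : k ≤ unionRank F ρ Finset.univ
  inter_lt : ∀ j, ((atomUnion F (Finset.univ \ {j}) ∩ F j).ncard : ℤ) < ρ j

/-- The index sets `J` with `|F_I| - ∑_{i ∈ I} η(F_i) < k` for all `I ⊆ J`; the sets `F_J` for
such `J` form the family `𝒵_{<k}`. -/
def IsSmallIndexSet {α : Type*} {m : ℕ} (F : Fin m → Set α) (k : ℤ) (ρ : Fin m → ℤ)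
    (J : Finset (Fin m)) : Prop :=
  ∀ I ⊆ J, unionRank F ρ I < k

/-- `M` is the matroid `M(F_1, …, F_m; k; ρ)` on `E`: its cyclic flats are the members of `𝒵_{<k}`
together with `E`, a member `F_J` of `𝒵_{<k}` has rank `|F_J| - ∑_{i ∈ J} η(F_i)`,
and `E` has rank `k`. -/
structure IsMatroidOfAtoms {α : Type*} {m : ℕ} (M : Matroid α) (E : Set α) (F : Fin m → Set α)
    (k : ℤ) (ρ : Fin m → ℤ) : Prop where
  ground_eq : M.E = E
  cyclicFlat_iff : ∀ X : Set α, IsCyclicFlat M X ↔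
    (∃ J, IsSmallIndexSet F k ρ J ∧ X = atomUnion F J) ∨ X = E
  rank_small : ∀ J, IsSmallIndexSet F k ρ J → rankZ M (atomUnion F J) = unionRank F ρ J
  rank_ground : rankZ M E = k

/-- `M` belongs to the class of all matroids `M(F_1, …, F_m; k; ρ)` arising from atom systems. -/
def IsAtomicMatroid {α : Type*} (M : Matroid α) : Prop :=
  ∃ (m : ℕ) (E : Set α) (F : Fin m → Set α) (k : ℤ) (ρ : Fin m → ℤ),
    IsAtomSystem E F k ρ ∧ IsMatroidOfAtoms M E F k ρ

/-- `⌈k / r⌉`. -/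
def ceilQuot (k r : ℤ) : ℤ := ⌈(k : ℚ) / (r : ℚ)⌉

/-- The right-hand side `n - k + 1 - (⌈k/r⌉ - 1)(δ - 1)` of the generalized Singleton bound. -/
def singletonBound (n k r δ : ℤ) : ℤ :=
  n - k + 1 - (ceilQuot k r - 1) * (δ - 1)

/-- `b = ⌈n/(r+δ-1)⌉ (r+δ-1) - n`. -/
def paramB (n r δ : ℤ) : ℤ :=
  ceilQuot n (r + δ - 1) * (r + δ - 1) - n

/-- `m = ⌈n/(r+δ-1)⌉ - 1`. -/
def paramM (n r δ : ℤ) : ℤ := ceilQuot n (r + δ - 1) - 1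

/-- `⌊(r+δ-1-b)/m⌋`. -/
def paramQ (n r δ : ℤ) : ℤ :=
  ⌊((r + δ - 1 - paramB n r δ : ℤ) : ℚ) / (paramM n r δ : ℚ)⌋

/-- `v = r+δ-1-b - ⌊(r+δ-1-b)/m⌋ m`. -/
def paramV (n r δ : ℤ) : ℤ :=
  r + δ - 1 - paramB n r δ - paramQ n r δ * paramM n r δ

/-- The bound `d_b(n, k, r, δ)`. -/
def distBound (n k r δ : ℤ) : ℤ :=
  if δ - 1 ≤ (ceilQuot k r - 1) * paramQ n r δ + min (paramV n r δ) (ceilQuot k r - 1) then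
    n - k + 1 - ceilQuot k r * (δ - 1)
  else
    n - k + 1 - (ceilQuot k r - 1) * (paramQ n r δ + δ - 1) -
      min (paramV n r δ) (ceilQuot k r - 1)

/-! Write t = ⌈k/r⌉ and X = `surplus n k r δ`, so that d_b = n-k+1 - ((t-1)(δ-1) + min(δ-1, X)). Two
facts reduce the theorem to counting with atoms. First, an F_J of rank below k forces d ≤ n-k+1 -
∑_{i∈J} η_i (`dist_le_of_gain_lt`); in the matroids constructed here, whose independent sets I
satisfy |I| ≤ k and |I ∩ F_J| ≤ `gain` J for all J, the best such J gives equality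
(`card_add_le_of_dual_circuit`). Second, locality forces every atom to have rank at most r and
nullity at least δ-1 (`locality_bounds`), and atoms of this kind conversely give locality
(`exists_isParamMatroid`).

Upper bound: let d > d_b. Any t atoms have nullity at least t(δ-1), too much for a set of rank below
k, so their gain is at least k. With at most m atoms, n = m(r+δ-1) + (mq+v) would force total
nullity beyond δ-1 per atom of at least mq+v; by averaging, some t-1 atoms would carry excess X
while having gain at most (t-1)r < k, giving d ≤ d_b. So there are at least m+1 atoms. Trimming
private elements until all nullities are δ-1, then adding fresh elements one by one up to n ≤
(m+1)(r+δ-1), yields a matroid meeting the Singleton-type bound, which is excluded.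

Tightness uses disjoint atoms: m atoms of rank r with evenly spread excess nullity, or m+1 atoms of
nullity δ-1 with one rank lowered by b. The latter matroid has one of two possible distances, and
the hypothesis excludes the larger. -/

set_option linter.unusedSectionVars false

/-! ### Sparse sets, tight constraints and the matroid they define. -/

namespace FinsetAtoms

variable {α ι : Type*} [DecidableEq α] [DecidableEq ι]

/-- The number of elements of `⋃_{i ∈ J} f i` minus the total nullity `∑_{i ∈ J} η i`. -/
def gain (f : ι → Finset α) (η : ι → ℤ) (J : Finset ι) : ℤ :=
  ((J.biUnion f).card : ℤ) - ∑ i ∈ J, η i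

/-- Each atom has more than `η j` elements outside any union of other atoms. -/
def HasPrivateParts (f : ι → Finset α) (η : ι → ℤ) : Prop :=
  ∀ (j : ι) (J : Finset ι), j ∉ J → η j < ((f j \ J.biUnion f).card : ℤ)

variable {f : ι → Finset α} {η : ι → ℤ} {J K : Finset ι}

lemma gain_empty : gain f η ∅ = 0 := by simp [gain]

lemma gain_singleton (j : ι) : gain f η {j} = (f j).card - η j := by simp [gain]

lemma gain_union (J K : Finset ι) :
    gain f η (J ∪ K) = gain f η J + ((K.biUnion f \ J.biUnion f).card : ℤ) -
      ∑ i ∈ K \ J, η i := by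
  have h1 : (J ∪ K).biUnion f = J.biUnion f ∪ (K.biUnion f \ J.biUnion f) := by
    rw [Finset.union_biUnion, Finset.union_sdiff_self_eq_union]
  have h2 : ∑ i ∈ J ∪ K, η i = ∑ i ∈ J, η i + ∑ i ∈ K \ J, η i := by
    rw [← Finset.union_sdiff_self_eq_union, Finset.sum_union Finset.disjoint_sdiff]
  rw [gain, h1, Finset.card_union_of_disjoint Finset.disjoint_sdiff, h2, gain]
  push_cast
  ring

lemma gain_insert {j : ι} (hj : j ∉ J) :
    gain f η (insert j J) = gain f η J + ((f j \ J.biUnion f).card : ℤ) - η j := by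
  have h := gain_union (f := f) (η := η) J {j}
  rwa [Finset.union_comm, ← Finset.insert_eq, Finset.singleton_biUnion,
    Finset.sdiff_eq_self_of_disjoint (Finset.disjoint_singleton_left.2 hj),
    Finset.sum_singleton] at h

lemma gain_strictMono (h : HasPrivateParts f η) : StrictMono (gain f η) := by
  rw [Finset.strictMono_iff_forall_lt_insert]
  intro J j hj
  rw [gain_insert hj]
  linarith [h j J hj]

lemma gain_nonneg (h : HasPrivateParts f η) (J : Finset ι) : 0 ≤ gain f η J := by
  rw [← gain_empty (f := f) (η := η)]
  exact (gain_strictMono h).monotone (Finset.empty_subset J)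

/-- The constraints cutting out the independent sets, without the bound on the rank. -/
def IsSparse (f : ι → Finset α) (η : ι → ℤ) (I : Finset α) : Prop :=
  ∀ J : Finset ι, ((I ∩ J.biUnion f).card : ℤ) ≤ gain f η J

/-- The constraint given by `J` holds with equality for `I`. -/
def IsTight (f : ι → Finset α) (η : ι → ℤ) (I : Finset α) (J : Finset ι) : Prop :=
  ((I ∩ J.biUnion f).card : ℤ) = gain f η J

variable {I : Finset α}

lemma IsSparse.mono {I' : Finset α} (h : IsSparse f η I) (hI : I' ⊆ I) : IsSparse f η I' :=
  fun J ↦ le_trans (by gcongr) (h J)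

lemma isTight_empty : IsTight f η I ∅ := by simp [IsTight, gain]

lemma card_inter_add (I A : Finset α) : ((I ∩ A).card : ℤ) = A.card - (A \ I).card := by
  have := Finset.card_sdiff_add_card_inter A I
  rw [Finset.inter_comm] at this
  omega

/-- Since |I ∩ F_J| = |F_J| - |F_J \ I|, sparsity means |F_J \ I| ≥ ∑_{i∈J} η_i. The left side is
submodular in J and the right side modular, so equality passes to unions. -/
lemma IsTight.union (h : IsSparse f η I) (hJ : IsTight f η I J) (hK : IsTight f η I K) :
    IsTight f η I (J ∪ K) := by
  have h1 := h (J ∩ K)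
  have h2 := h (J ∪ K)
  unfold IsTight at *
  rw [card_inter_add, gain] at *
  have h3 : ∑ i ∈ J ∪ K, η i + ∑ i ∈ J ∩ K, η i = ∑ i ∈ J, η i + ∑ i ∈ K, η i :=
    Finset.sum_union_inter
  have h4 : (((J ∪ K).biUnion f \ I).card : ℤ) + (((J ∩ K).biUnion f \ I).card : ℤ) ≤
      ((J.biUnion f \ I).card : ℤ) + ((K.biUnion f \ I).card : ℤ) := by
    have h5 := Finset.card_union_add_card_inter (J.biUnion f \ I) (K.biUnion f \ I)
    have h6 : (J ∪ K).biUnion f \ I = (J.biUnion f \ I) ∪ (K.biUnion f \ I) := by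
      rw [Finset.union_biUnion, Finset.union_sdiff_distrib]
    have h7 : ((J ∩ K).biUnion f \ I).card ≤
        ((J.biUnion f \ I) ∩ (K.biUnion f \ I)).card := by
      apply Finset.card_le_card
      intro x hx
      simp only [Finset.mem_sdiff, Finset.mem_biUnion, Finset.mem_inter] at hx ⊢
      obtain ⟨⟨i, ⟨hi, hi'⟩, hxi⟩, hxI⟩ := hx
      exact ⟨⟨⟨i, hi, hxi⟩, hxI⟩, ⟨i, hi', hxi⟩, hxI⟩
    rw [h6]
    omega
  linarith

lemma exists_isTight_cover (h : IsSparse f η I) (X : Finset α)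
    (hX : ∀ x ∈ X, ∃ J, x ∈ J.biUnion f ∧ IsTight f η I J) :
    ∃ J, X ⊆ J.biUnion f ∧ IsTight f η I J := by
  induction X using Finset.induction_on with
  | empty => exact ⟨∅, by simp, isTight_empty⟩
  | insert x X _ ih =>
    obtain ⟨J, hJ, hJt⟩ := ih fun y hy ↦ hX y (Finset.mem_insert_of_mem hy)
    obtain ⟨K, hK, hKt⟩ := hX x (Finset.mem_insert_self x X)
    refine ⟨K ∪ J, ?_, hKt.union h hJt⟩
    rw [Finset.union_biUnion]
    exact Finset.insert_subset (Finset.mem_union_left _ hK)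
      (hJ.trans Finset.subset_union_right)

lemma exists_isTight_of_not_insert {x : α} (h : IsSparse f η I) (hx : ¬ IsSparse f η (insert x I)) :
    ∃ J, x ∈ J.biUnion f ∧ IsTight f η I J := by
  simp only [IsSparse, not_forall, not_le] at hx
  obtain ⟨J, hJ⟩ := hx
  by_cases hxJ : x ∈ J.biUnion f
  · refine ⟨J, hxJ, le_antisymm (h J) ?_⟩
    rw [Finset.insert_inter_of_mem hxJ] at hJ
    have := Finset.card_insert_le x (I ∩ J.biUnion f)
    omega
  · rw [Finset.insert_inter_of_notMem hxJ] at hJ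
    exact absurd (h J) (not_le.2 hJ)

variable [Fintype ι]

/-- The independent sets of the matroid with atoms `f i` truncated to rank `k`. -/
def AtomIndep (f : ι → Finset α) (η : ι → ℤ) (k : ℤ) (I : Finset α) : Prop :=
  I ⊆ Finset.univ.biUnion f ∧ (I.card : ℤ) ≤ k ∧ IsSparse f η I

variable {k : ℤ}

/-- Below size k only tight constraints block an extension, and their union is a single tight
constraint blocking all of X \ I. The rank, flat and cocircuit computations rest on this J. -/
lemma exists_cover_of_forall_insert {X : Finset α} (hX : X ⊆ Finset.univ.biUnion f)
    (hI : AtomIndep f η k I) (hIk : (I.card : ℤ) < k)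
    (hmax : ∀ x ∈ X, x ∉ I → ¬ AtomIndep f η k (insert x I)) :
    ∃ J, X \ I ⊆ J.biUnion f ∧ IsTight f η I J := by
  refine exists_isTight_cover hI.2.2 _ fun x hx ↦ ?_
  rw [Finset.mem_sdiff] at hx
  refine exists_isTight_of_not_insert hI.2.2 fun hs ↦ hmax x hx.1 hx.2 ⟨?_, ?_, hs⟩
  · exact Finset.insert_subset (hX hx.1) hI.1
  · rw [Finset.card_insert_of_notMem hx.2]
    push_cast
    omega

/-- If nothing in B extends I, one tight F_J contains B \ I. Outside F_J the set B lies in I, and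
inside F_J the set I already has the largest size allowed, so |B| ≤ |I|. -/
lemma AtomIndep.exists_insert {B : Finset α} (hI : AtomIndep f η k I) (hB : AtomIndep f η k B)
    (hIB : I.card < B.card) : ∃ e ∈ B, e ∉ I ∧ AtomIndep f η k (insert e I) := by
  by_contra! hcon
  have hB2 := hB.2.1
  obtain ⟨J, hJ, hJt⟩ := exists_cover_of_forall_insert hB.1 hI (by omega) hcon
  have h1 := hB.2.2 J
  unfold IsTight at hJt
  have h2 : (B \ J.biUnion f).card ≤ (I \ J.biUnion f).card := by
    apply Finset.card_le_card
    intro x hx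
    rw [Finset.mem_sdiff] at hx ⊢
    refine ⟨?_, hx.2⟩
    by_contra hxI
    exact hx.2 (hJ (Finset.mem_sdiff.2 ⟨hx.1, hxI⟩))
  have h3 := Finset.card_sdiff_add_card_inter B (J.biUnion f)
  have h4 := Finset.card_sdiff_add_card_inter I (J.biUnion f)
  omega

lemma atomIndep_empty (hk : 0 ≤ k) (h : HasPrivateParts f η) : AtomIndep f η k ∅ :=
  ⟨by simp, by simpa using hk, fun J ↦ by simpa using gain_nonneg h J⟩

lemma AtomIndep.mono {I' : Finset α} (hI : AtomIndep f η k I) (h : I' ⊆ I) : AtomIndep f η k I' :=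
  ⟨h.trans hI.1, le_trans (by exact_mod_cast Finset.card_le_card h) hI.2.1, hI.2.2.mono h⟩

/-- The matroid with atoms `f i` of nullity `η i`, truncated to rank `k`. -/
def atomMatroid (f : ι → Finset α) (η : ι → ℤ) (k : ℤ) (hk : 0 ≤ k)
    (h : HasPrivateParts f η) : Matroid α :=
  (IndepMatroid.ofFinset (↑(Finset.univ.biUnion f)) (AtomIndep f η k) (atomIndep_empty hk h)
    (fun _ _ hJ hIJ ↦ AtomIndep.mono hJ hIJ)
    (fun _ _ hI hJ hIJ ↦ AtomIndep.exists_insert hI hJ hIJ)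
    (fun _ hI ↦ Finset.coe_subset.2 hI.1)).matroid

section

variable {hk : 0 ≤ k} {h : HasPrivateParts f η}

@[simp] lemma atomMatroid_ground :
    (atomMatroid f η k hk h).E = ↑(Finset.univ.biUnion f) := rfl

@[simp] lemma atomMatroid_indep_iff :
    (atomMatroid f η k hk h).Indep ↑I ↔ AtomIndep f η k I := by
  unfold atomMatroid
  rw [IndepMatroid.matroid_Indep, IndepMatroid.ofFinset_indep]

lemma exists_isBasis_coe {X : Finset α} (hX : X ⊆ Finset.univ.biUnion f) :
    ∃ I : Finset α, (atomMatroid f η k hk h).IsBasis ↑I ↑X := by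
  obtain ⟨I, hI⟩ := (atomMatroid f η k hk h).exists_isBasis ↑X (by exact_mod_cast hX)
  have hfin : I.Finite := X.finite_toSet.subset hI.subset
  exact ⟨hfin.toFinset, by simpa using hI⟩

lemma exists_cover_of_isBasis {X : Finset α}
    (hI : (atomMatroid f η k hk h).IsBasis ↑I ↑X) (hIk : (I.card : ℤ) < k) :
    ∃ J, X \ I ⊆ J.biUnion f ∧ IsTight f η I J := by
  refine exists_cover_of_forall_insert (by exact_mod_cast hI.subset_ground)
    (atomMatroid_indep_iff.1 hI.indep) hIk fun x hx hxI hxi ↦ ?_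
  rw [← atomMatroid_indep_iff (hk := hk) (h := h), Finset.coe_insert] at hxi
  exact hxI (by exact_mod_cast hI.mem_of_insert_indep (by exact_mod_cast hx) hxi)

end

end FinsetAtoms

/-! ### Ranks and cyclic flats of the atom matroid. -/

lemma rankZ_eq_of_isBasis {α : Type*} {M : Matroid α} {I : Finset α} {X : Set α}
    (hI : M.IsBasis ↑I X) : rankZ M X = I.card := by
  simp [rankZ, hI.eRk_eq_encard]

lemma isCyclicSet_of_forall_mem_closure {α : Type*} {M : Matroid α} {X : Set α}
    (hX : ∀ e ∈ X, e ∈ M.closure (X \ {e})) : IsCyclicSet M X := by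
  refine ⟨{C | M.IsCircuit C ∧ C ⊆ X}, fun C hC ↦ hC.1,
    Set.Subset.antisymm (Set.sUnion_subset fun C hC ↦ hC.2) fun e he ↦ ?_⟩
  obtain ⟨C, hCX, hC, heC⟩ := Matroid.exists_isCircuit_of_mem_closure (hX e he) (by simp)
  refine ⟨C, ⟨hC, hCX.trans ?_⟩, heC⟩
  rw [Set.insert_sdiff_singleton, Set.insert_eq_of_mem he]

lemma IsCyclicSet.mem_closure {α : Type*} {M : Matroid α} {X : Set α} (hX : IsCyclicSet M X) {e : α}
    (he : e ∈ X) : e ∈ M.closure (X \ {e}) := by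
  obtain ⟨𝒞, h𝒞, rfl⟩ := hX
  obtain ⟨C, hC, heC⟩ := he
  exact M.closure_subset_closure (Set.sdiff_subset_sdiff_left (Set.subset_sUnion_of_mem hC))
    ((h𝒞 C hC).mem_closure_sdiff_singleton_of_mem heC)

namespace FinsetAtoms

variable {α : Type*} [DecidableEq α] {m : ℕ} {f : Fin m → Finset α} {η : Fin m → ℤ}

lemma atomUnion_coe (J : Finset (Fin m)) :
    atomUnion (fun j ↦ (f j : Set α)) J = ↑(J.biUnion f) := by
  simp [atomUnion]

lemma unionRank_coe {ρ : Fin m → ℤ} (hρ : ∀ j, ρ j = (f j).card - η j) (J : Finset (Fin m)) :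
    unionRank (fun j ↦ (f j : Set α)) ρ J = gain f η J := by
  rw [unionRank, atomUnion_coe, Set.ncard_coe_finset]
  simp [gain, atomNullity, hρ, Set.ncard_coe_finset]

/-- Private parts make `gain` monotone, so the condition on all subsets of J collapses to the one on
J. -/
lemma isSmallIndexSet_coe_iff {ρ : Fin m → ℤ} {k : ℤ} {J : Finset (Fin m)}
    (hρ : ∀ j, ρ j = (f j).card - η j) (h : HasPrivateParts f η) :
    IsSmallIndexSet (fun j ↦ (f j : Set α)) k ρ J ↔ gain f η J < k := by
  simp only [IsSmallIndexSet, unionRank_coe hρ]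
  exact ⟨fun hJ ↦ hJ J subset_rfl,
    fun hJ I hI ↦ ((gain_strictMono h).monotone hI).trans_lt hJ⟩

variable {J : Finset (Fin m)} {I X : Finset α} {k : ℤ}

lemma biUnion_subset_univ (J : Finset (Fin m)) : J.biUnion f ⊆ Finset.univ.biUnion f :=
  Finset.biUnion_subset_biUnion_of_subset_left f (Finset.subset_univ J)

variable {hk : 0 ≤ k} {h : HasPrivateParts f η}

lemma card_eq_of_isTight_cover {K : Finset (Fin m)} (hIX : I ⊆ X) (hX : X \ I ⊆ K.biUnion f)
    (hK : IsTight f η I K) : (I.card : ℤ) = gain f η K + (X \ K.biUnion f).card := by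
  have h1 := Finset.card_sdiff_add_card_inter I (K.biUnion f)
  have h2 : I \ K.biUnion f = X \ K.biUnion f := by
    apply Finset.Subset.antisymm (Finset.sdiff_subset_sdiff hIX subset_rfl)
    intro x hx
    rw [Finset.mem_sdiff] at hx ⊢
    refine ⟨?_, hx.2⟩
    by_contra hxI
    exact hx.2 (hX (Finset.mem_sdiff.2 ⟨hx.1, hxI⟩))
  unfold IsTight at hK
  rw [h2] at h1
  omega

lemma gain_union_le (hη : ∀ i, 0 ≤ η i) (J K : Finset (Fin m)) :
    gain f η (K ∪ J) ≤ gain f η K + (J.biUnion f \ K.biUnion f).card := by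
  rw [gain_union]
  have : 0 ≤ ∑ i ∈ J \ K, η i := Finset.sum_nonneg fun i _ ↦ hη i
  omega

/-- The rank of a union of atoms. -/
lemma card_isBasis_biUnion (hη : ∀ i, 0 ≤ η i)
    (hI : (atomMatroid f η k hk h).IsBasis ↑I ↑(J.biUnion f)) :
    (I.card : ℤ) = min k (gain f η J) := by
  have hind := atomMatroid_indep_iff.1 hI.indep
  have hsub : I ⊆ J.biUnion f := by exact_mod_cast hI.subset
  have h1 := hind.2.2 J
  have h0 := hind.2.1
  rw [Finset.inter_eq_left.2 hsub] at h1
  by_cases hlt : (I.card : ℤ) < k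
  · obtain ⟨K, hK, hKt⟩ := exists_cover_of_isBasis hI hlt
    have h2 := card_eq_of_isTight_cover hsub hK hKt
    have h3 := gain_union_le (f := f) hη J K
    have h4 : gain f η J ≤ gain f η (K ∪ J) :=
      (gain_strictMono h).monotone Finset.subset_union_right
    rw [min_eq_right (by omega)]
    omega
  · rw [min_eq_left (by omega)]
    omega

lemma rankZ_biUnion (hη : ∀ i, 0 ≤ η i) (J : Finset (Fin m)) :
    rankZ (atomMatroid f η k hk h) ↑(J.biUnion f) = min k (gain f η J) := by
  obtain ⟨I, hI⟩ := exists_isBasis_coe (hk := hk) (h := h) (biUnion_subset_univ J)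
  rw [rankZ_eq_of_isBasis hI, card_isBasis_biUnion hη hI]

lemma notMem_closure_of_insert_indep {M : Matroid α} {X : Set α} {e : α} (he : e ∈ M.E)
    (hI : M.IsBasis ↑I X) (hins : M.Indep (insert e ↑I)) (heI : e ∉ I) : e ∉ M.closure X := by
  rw [← hI.closure_eq_closure, hI.indep.notMem_closure_iff he]
  exact ⟨hins, by simpa using heI⟩

lemma isFlat_of_gain_lt (hη : ∀ i, 0 ≤ η i) (hJ : gain f η J < k) :
    (atomMatroid f η k hk h).IsFlat ↑(J.biUnion f) := by
  have hsub : ((J.biUnion f : Finset α) : Set α) ⊆ (atomMatroid f η k hk h).E := by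
    rw [atomMatroid_ground]
    exact_mod_cast biUnion_subset_univ J
  rw [Matroid.isFlat_iff_closure_eq]
  refine Set.Subset.antisymm (fun x hx ↦ ?_) (Matroid.subset_closure _ _ hsub)
  by_contra hxJ
  have hxE := Matroid.mem_ground_of_mem_closure hx
  obtain ⟨I, hI⟩ := exists_isBasis_coe (hk := hk) (h := h) (biUnion_subset_univ J)
  have hIsub : I ⊆ J.biUnion f := by exact_mod_cast hI.subset
  have hxI : x ∉ I := fun hxI ↦ hxJ (by exact_mod_cast hIsub hxI)
  have hcard := card_isBasis_biUnion hη hI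
  rw [min_eq_right hJ.le] at hcard
  refine notMem_closure_of_insert_indep hxE hI ?_ hxI hx
  rw [← Finset.coe_insert, atomMatroid_indep_iff]
  have hind := atomMatroid_indep_iff.1 hI.indep
  refine ⟨Finset.insert_subset (by exact_mod_cast hxE) hind.1, ?_, ?_⟩
  · rw [Finset.card_insert_of_notMem hxI]
    push_cast
    omega
  · by_contra hns
    obtain ⟨K, hxK, hK⟩ := exists_isTight_of_not_insert hind.2.2 hns
    have hJt : IsTight f η I J := by
      unfold IsTight
      rw [Finset.inter_eq_left.2 hIsub, hcard]
    -- As I ⊆ F_J, tightness of J ∪ K means gain (J ∪ K) = |I| = gain J, and strict monotonicity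
    -- forces K ⊆ J.
    have hu := hJt.union hind.2.2 hK
    unfold IsTight at hu
    rw [Finset.inter_eq_left.2 (hIsub.trans
      (Finset.biUnion_subset_biUnion_of_subset_left f Finset.subset_union_left)), hcard] at hu
    have hKJ : J ∪ K = J := by
      by_contra hne
      have := gain_strictMono h
        (Finset.subset_union_left.ssubset_of_ne (Ne.symm hne) : J ⊂ J ∪ K)
      omega
    rw [Finset.union_eq_left] at hKJ
    exact hxJ (by exact_mod_cast Finset.biUnion_subset_biUnion_of_subset_left f hKJ hxK)

/-- If e were a coloop of F_J, a basis I of F_J \ {e} would have a tight cover K with e ∉ F_K. Then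
|I| + 1 = gain K + |F_J \ F_K| exceeds gain (K ∪ J) ≥ gain J by the positive nullity of J \ K,
contradicting the rank of F_J. -/
lemma mem_closure_biUnion_diff (hη : ∀ i, 0 < η i) {e : α} (he : e ∈ J.biUnion f) :
    e ∈ (atomMatroid f η k hk h).closure (↑(J.biUnion f) \ {e}) := by
  have hη' : ∀ i, 0 ≤ η i := fun i ↦ (hη i).le
  have heE : e ∈ (atomMatroid f η k hk h).E := by
    rw [atomMatroid_ground]
    exact_mod_cast biUnion_subset_univ J he
  by_contra hcl
  obtain ⟨I, hI⟩ := exists_isBasis_coe (hk := hk) (h := h)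
    ((Finset.erase_subset e _).trans (biUnion_subset_univ J))
  have heI : e ∉ I := fun heI ↦ by
    have : e ∈ (J.biUnion f).erase e := by exact_mod_cast hI.subset heI
    simp at this
  rw [← Finset.coe_erase, ← hI.closure_eq_closure,
    hI.indep.notMem_closure_iff_of_notMem (by exact_mod_cast heI)] at hcl
  have hB := hI.insert_isBasis_insert hcl
  rw [← Finset.coe_insert, ← Finset.coe_insert, Finset.insert_erase he] at hB
  rw [← Finset.coe_insert, atomMatroid_indep_iff] at hcl
  have hcard := card_isBasis_biUnion hη' hB
  rw [Finset.card_insert_of_notMem heI] at hcard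
  push_cast at hcard
  obtain ⟨K, hK, hKt⟩ := exists_cover_of_isBasis hI (by
    have := min_le_left k (gain f η J)
    omega)
  have hc := card_eq_of_isTight_cover (by exact_mod_cast hI.subset) hK hKt
  have heK : e ∉ K.biUnion f := fun heK ↦ by
    have h1 := hcl.2.2 K
    rw [Finset.insert_inter_of_mem heK, Finset.card_insert_of_notMem
      (fun h' ↦ heI (Finset.mem_inter.1 h').1)] at h1
    unfold IsTight at hKt
    push_cast at h1
    omega
  rw [Finset.erase_sdiff_comm, Finset.card_erase_of_mem (Finset.mem_sdiff.2 ⟨he, heK⟩)] at hc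
  have hpos : 0 < (J.biUnion f \ K.biUnion f).card :=
    Finset.card_pos.2 ⟨e, Finset.mem_sdiff.2 ⟨he, heK⟩⟩
  have hu := gain_union (f := f) (η := η) K J
  have hm : gain f η J ≤ gain f η (K ∪ J) :=
    (gain_strictMono h).monotone Finset.subset_union_right
  have hmin := min_le_right k (gain f η J)
  have hne : (J \ K).Nonempty := by
    rw [Finset.sdiff_nonempty]
    exact fun hJK ↦ heK (Finset.biUnion_subset_biUnion_of_subset_left f hJK he)
  have hs : 0 < ∑ i ∈ J \ K, η i := Finset.sum_pos (fun i _ ↦ hη i) hne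
  omega

lemma isCyclicSet_biUnion (hη : ∀ i, 0 < η i) (J : Finset (Fin m)) :
    IsCyclicSet (atomMatroid f η k hk h) ↑(J.biUnion f) :=
  isCyclicSet_of_forall_mem_closure fun _ he ↦
    mem_closure_biUnion_diff hη (by exact_mod_cast he)

lemma closure_biUnion_subset (hI : (atomMatroid f η k hk h).Indep ↑I) (hIJ : IsTight f η I J) :
    ↑(J.biUnion f) ⊆ (atomMatroid f η k hk h).closure ↑I := by
  have hind : (atomMatroid f η k hk h).Indep ↑(I ∩ J.biUnion f) :=
    hI.subset (by exact_mod_cast Finset.inter_subset_left)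
  have hb : (atomMatroid f η k hk h).IsBasis ↑(I ∩ J.biUnion f) ↑(J.biUnion f) := by
    refine hind.isBasis_of_maximal_subset (by exact_mod_cast Finset.inter_subset_right) ?_ ?hXE
    case hXE => exact Finset.coe_subset.2 (biUnion_subset_univ J)
    intro B hB hIB hBJ
    have hfin : B.Finite := (J.biUnion f).finite_toSet.subset hBJ
    lift B to Finset α using hfin
    have h1 := (atomMatroid_indep_iff.1 hB).2.2 J
    rw [Finset.inter_eq_left.2 (by exact_mod_cast hBJ)] at h1
    unfold IsTight at hIJ
    have := Finset.eq_of_subset_of_card_le (s := I ∩ J.biUnion f) (t := B)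
      (by exact_mod_cast hIB) (by omega)
    rw [this]
  exact hb.subset_closure.trans
    (Matroid.closure_subset_closure _ (by exact_mod_cast Finset.inter_subset_left))

/-- If the rank is below k, the tight F_J covering X \ I lies in the closure of I, which is X. An
element of X outside F_J would be a coloop of the restriction to X, impossible in a union of
circuits. If the rank is k, then X spans. -/
lemma eq_of_isCyclicFlat {X : Set α}
    (hX : IsCyclicFlat (atomMatroid f η k hk h) X) :
    (∃ J, gain f η J < k ∧ X = ↑(J.biUnion f)) ∨ X = ↑(Finset.univ.biUnion f) := by
  have hXE : X ⊆ ↑(Finset.univ.biUnion f) := hX.1.subset_ground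
  lift X to Finset α using (Finset.finite_toSet _).subset hXE
  obtain ⟨I, hI⟩ := exists_isBasis_coe (hk := hk) (h := h) (by exact_mod_cast hXE)
  have hIX : I ⊆ X := by exact_mod_cast hI.subset
  have hind := atomMatroid_indep_iff.1 hI.indep
  have hcl : (atomMatroid f η k hk h).closure ↑I = ↑X := by
    rw [hI.closure_eq_closure, hX.1.closure]
  by_cases hlt : (I.card : ℤ) < k
  · left
    obtain ⟨J, hJ, hJt⟩ := exists_cover_of_isBasis hI hlt
    have hc := card_eq_of_isTight_cover hIX hJ hJt
    have hJX : J.biUnion f ⊆ X := by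
      have := closure_biUnion_subset hI.indep hJt
      rw [hcl] at this
      exact_mod_cast this
    refine ⟨J, by omega, ?_⟩
    rw [Finset.coe_inj]
    refine Finset.Subset.antisymm (fun x hx ↦ ?_) hJX
    by_contra hxJ
    have hxI : x ∈ I := by
      by_contra hxI
      exact hxJ (hJ (Finset.mem_sdiff.2 ⟨hx, hxI⟩))
    refine hI.indep.notMem_closure_sdiff_of_mem (by exact_mod_cast hxI) ?_
    have hsub : (↑X \ {x} : Set α) ⊆ (atomMatroid f η k hk h).closure (↑I \ {x}) := by
      intro y hy
      have hyX : y ∈ X := by exact_mod_cast hy.1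
      by_cases hyJ : y ∈ J.biUnion f
      · have hJt' : IsTight f η (I.erase x) J := by
          unfold IsTight at hJt ⊢
          rwa [Finset.erase_inter, Finset.erase_eq_of_notMem (by simp [hxJ])]
        rw [← Finset.coe_erase]
        exact closure_biUnion_subset
          (hI.indep.subset (by exact_mod_cast Finset.erase_subset x I)) hJt'
          (by exact_mod_cast hyJ)
      · have hyI : y ∈ I := by
          by_contra hyI
          exact hyJ (hJ (Finset.mem_sdiff.2 ⟨hyX, hyI⟩))
        exact Matroid.mem_closure_of_mem' _ ⟨by exact_mod_cast hyI, hy.2⟩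
          (hI.indep.subset_ground (by exact_mod_cast hyI))
    have := Matroid.closure_subset_closure_of_subset_closure hsub
    exact this (hX.2.mem_closure (by exact_mod_cast hx))
  · right
    refine Set.Subset.antisymm hXE fun x hx ↦ ?_
    by_contra hxX
    rw [← hcl, hI.indep.notMem_closure_iff hx, ← Finset.coe_insert, atomMatroid_indep_iff] at hxX
    have h1 := hxX.1.2.1
    rw [Finset.card_insert_of_notMem (by exact_mod_cast hxX.2)] at h1
    push_cast at h1
    omega

theorem isMatroidOfAtoms_atomMatroid (hη : ∀ i, 0 < η i) {ρ : Fin m → ℤ}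
    (hρ : ∀ j, ρ j = (f j).card - η j) (hku : k ≤ gain f η Finset.univ) :
    IsMatroidOfAtoms (atomMatroid f η k hk h) ↑(Finset.univ.biUnion f)
      (fun j ↦ (f j : Set α)) k ρ where
  ground_eq := rfl
  cyclicFlat_iff X := by
    simp only [isSmallIndexSet_coe_iff hρ h, atomUnion_coe]
    refine ⟨eq_of_isCyclicFlat, ?_⟩
    rintro (⟨J, hJ, rfl⟩ | rfl)
    · exact ⟨isFlat_of_gain_lt (fun i ↦ (hη i).le) hJ, isCyclicSet_biUnion hη J⟩
    · exact ⟨Matroid.ground_isFlat _, isCyclicSet_biUnion hη _⟩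
  rank_small J hJ := by
    rw [isSmallIndexSet_coe_iff hρ h] at hJ
    rw [atomUnion_coe, unionRank_coe hρ, rankZ_biUnion fun i ↦ (hη i).le, min_eq_right hJ.le]
  rank_ground := by
    rw [rankZ_biUnion fun i ↦ (hη i).le, min_eq_left hku]

end FinsetAtoms

/-! ### Cocircuits and locality of the atom matroid. -/

lemma exists_cocircuit_ncard_le {α : Type*} {M : Matroid α} (hM : M.E.Finite) {F : Set α}
    (hF : F ⊆ M.E) (hlt : rankZ M F < rankZ M M.E) :
    ∃ X, M✶.IsCircuit X ∧
      (X.ncard : ℤ) ≤ M.E.ncard - rankZ M M.E + 1 - (F.ncard - rankZ M F) := by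
  obtain ⟨I, hI⟩ := M.exists_isBasis F
  obtain ⟨B, hB, hIB⟩ := hI.indep.exists_isBase_superset
  have hBfin : B.Finite := hM.subset hB.subset_ground
  have hFfin : F.Finite := hM.subset hF
  have hr1 : rankZ M F = I.ncard := by rw [rankZ, hI.eRk_eq_encard, Set.ncard_def]
  have hr2 : rankZ M M.E = B.ncard := by
    rw [rankZ, hB.isBasis_ground.eRk_eq_encard, Set.ncard_def]
  have hne : (B \ I).Nonempty := by
    rw [Set.nonempty_iff_ne_empty, Ne, Set.sdiff_eq_empty]
    intro hBI
    rw [hr1, hr2, Set.Subset.antisymm hBI hIB] at hlt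
    exact lt_irrefl _ hlt
  obtain ⟨e, heB, heI⟩ := hne
  -- The hyperplane spanned by B \ {e} contains F ∪ (B \ {e}), which has at least |F| + |B| - 1 -
  -- |I| elements.
  refine ⟨_, (hB.compl_closure_sdiff_singleton_isCocircuit heB).isCircuit, ?_⟩
  have hBF : B ∩ F = I := hI.inter_eq_of_subset_indep hIB hB.indep
  have heF : e ∉ F := fun heF ↦ heI (hBF ▸ ⟨heB, heF⟩)
  have hIe : I ⊆ B \ {e} := fun x hx ↦ ⟨hIB hx, fun hxe ↦ heI (hxe ▸ hx)⟩
  have hsub : F ∪ (B \ {e}) ⊆ M.closure (B \ {e}) := by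
    refine Set.union_subset (hI.subset_closure.trans (M.closure_subset_closure hIe))
      (M.subset_closure _ (Set.sdiff_subset.trans hB.subset_ground))
  have h1 : (M.E \ M.closure (B \ {e})).ncard ≤ (M.E \ (F ∪ (B \ {e}))).ncard :=
    Set.ncard_le_ncard (Set.sdiff_subset_sdiff_right hsub) (hM.subset Set.sdiff_subset)
  have h2 : (M.E \ (F ∪ (B \ {e}))).ncard + (F ∪ (B \ {e})).ncard = M.E.ncard :=
    Set.ncard_sdiff_add_ncard_of_subset
      (Set.union_subset hF (Set.sdiff_subset.trans hB.subset_ground)) hM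
  have h3 := Set.ncard_union_add_ncard_inter F (B \ {e}) hFfin (hBfin.subset Set.sdiff_subset)
  have h4 : F ∩ (B \ {e}) ⊆ I := by
    rw [← hBF]
    exact fun x hx ↦ ⟨hx.2.1, hx.1⟩
  have h5 : (F ∩ (B \ {e})).ncard ≤ I.ncard := Set.ncard_le_ncard h4 (hBfin.subset hIB)
  have h6 := Set.ncard_sdiff_singleton_add_one heB hBfin
  omega

namespace FinsetAtoms

variable {α : Type u} [DecidableEq α] {m : ℕ} {f : Fin m → Finset α} {η : Fin m → ℤ}
  {k : ℤ} {hk : 0 ≤ k} {h : HasPrivateParts f η}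

/-- Atoms restrict to uniform matroids. For j ∉ J, the inequality gain {j} ≤ gain (J ∪ {j})
rearranges to |F_j ∩ F_J| ≤ gain J, so only constraints with j ∈ J could bind, and those follow from
monotonicity. -/
lemma atomIndep_of_subset_atom (h : HasPrivateParts f η) {j : Fin m} {B : Finset α}
    (hB : B ⊆ f j) (hcard : (B.card : ℤ) ≤ gain f η {j}) (hk : gain f η {j} ≤ k) :
    AtomIndep f η k B := by
  have hmono := (gain_strictMono h).monotone
  refine ⟨hB.trans (Finset.subset_biUnion_of_mem f (Finset.mem_univ j)), by omega, fun J ↦ ?_⟩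
  by_cases hj : j ∈ J
  · have h1 : (B ∩ J.biUnion f).card ≤ B.card := Finset.card_le_card Finset.inter_subset_left
    have h2 := hmono (Finset.singleton_subset_iff.2 hj)
    omega
  · have h1 := gain_insert (f := f) (η := η) hj
    have h2 := hmono (Finset.singleton_subset_iff.2 (Finset.mem_insert_self j J))
    have h3 : (B ∩ J.biUnion f).card ≤ (f j ∩ J.biUnion f).card :=
      Finset.card_le_card (Finset.inter_subset_inter_right hB)
    have h4 := Finset.card_sdiff_add_card_inter (f j) (J.biUnion f)
    rw [gain_singleton] at h2
    omega

/-- The restriction to S is uniform of nullity δ-1, so fewer than δ elements can be avoided by a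
basis. A subset of the atom is used because an atom of larger nullity may have more than r+δ-1
elements. -/
lemma isLocalitySet_of_subset_atom {r δ : ℤ} {j : Fin m} {S : Finset α} (hS : S ⊆ f j)
    (hcard : (S.card : ℤ) = gain f η {j} + δ - 1) (hr : gain f η {j} ≤ r)
    (hrk : gain f η {j} ≤ k) : IsLocalitySet (atomMatroid f η k hk h) r δ ↑S := by
  have hSE : (S : Set α) ⊆ (atomMatroid f η k hk h).E := Finset.coe_subset.2
    (hS.trans (Finset.subset_biUnion_of_mem f (Finset.mem_univ j)))
  have hg := gain_nonneg h {j}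
  refine ⟨hSE, by rw [Set.ncard_coe_finset]; omega, fun X hX ↦ ?_⟩
  have hXS : X ⊆ ↑S := hX.subset_ground
  lift X to Finset α using S.finite_toSet.subset hXS
  rw [Set.ncard_coe_finset]
  by_contra! hlt
  have hdep := (Matroid.dual_dep_iff_forall.1 hX.dep).1
  have h1 := Finset.card_sdiff_add_card_eq_card (Finset.coe_subset.1 hXS)
  obtain ⟨B, hBS, hB⟩ := Finset.exists_subset_card_eq
    (s := S \ X) (n := (gain f η {j}).toNat) (by omega)
  have hBS' : B ⊆ S := hBS.trans Finset.sdiff_subset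
  have hBcard : (B.card : ℤ) = gain f η {j} := by omega
  have hind : (atomMatroid f η k hk h).Indep ↑B :=
    atomMatroid_indep_iff.2 (atomIndep_of_subset_atom h (hBS'.trans hS) hBcard.le hrk)
  have hbasis : (atomMatroid f η k hk h).IsBasis ↑B ↑S := by
    refine hind.isBasis_of_maximal_subset (Finset.coe_subset.2 hBS') (fun I hI hBI hIS ↦ ?_) hSE
    lift I to Finset α using S.finite_toSet.subset hIS
    have h2 := (atomMatroid_indep_iff.1 hI).2.2 {j}
    rw [Finset.singleton_biUnion, Finset.inter_eq_left.2 ((Finset.coe_subset.1 hIS).trans hS)] at h2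
    rw [Finset.eq_of_subset_of_card_le (Finset.coe_subset.1 hBI) (by omega)]
  obtain ⟨x, hxX, hxB⟩ := hdep _ (Matroid.isBase_restrict_iff hSE |>.2 hbasis)
  exact (Finset.mem_sdiff.1 (hBS (Finset.mem_coe.1 hxB))).2 (Finset.mem_coe.1 hxX)

/-- The complement of X does not span, so a basis I of it has a tight cover J, and k - 1 ≥ |I| ≥ |E
\ X| - ∑_{i∈J} η_i. -/
lemma card_add_le_of_dual_circuit {X : Set α} (hX : (atomMatroid f η k hk h)✶.IsCircuit X) :
    ∃ J, gain f η J < k ∧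
      ((Finset.univ.biUnion f).card : ℤ) - k + 1 - ∑ i ∈ J, η i ≤ X.ncard := by
  have hXE : X ⊆ ↑(Finset.univ.biUnion f) := hX.subset_ground
  lift X to Finset α using (Finset.finite_toSet _).subset hXE
  have hXE' := Finset.coe_subset.1 hXE
  have hdep := (Matroid.dual_dep_iff_forall.1 hX.dep).1
  obtain ⟨I, hI⟩ := exists_isBasis_coe (hk := hk) (h := h)
    (Finset.sdiff_subset (s := Finset.univ.biUnion f) (t := X))
  have hIX : I ⊆ Finset.univ.biUnion f \ X := Finset.coe_subset.1 hI.subset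
  have hind := atomMatroid_indep_iff.1 hI.indep
  have hlt : (I.card : ℤ) < k := by
    by_contra hge
    have hbase : (atomMatroid f η k hk h).IsBase ↑I := by
      refine hI.indep.isBase_of_maximal fun B hB hIB ↦ ?_
      have hBE := hB.subset_ground
      lift B to Finset α using (Finset.finite_toSet _).subset hBE
      have h2 := (atomMatroid_indep_iff.1 hB).2.1
      rw [Finset.eq_of_subset_of_card_le (Finset.coe_subset.1 hIB) (by omega)]
    obtain ⟨x, hxX, hxI⟩ := hdep _ hbase
    exact (Finset.mem_sdiff.1 (hIX (Finset.mem_coe.1 hxI))).2 (Finset.mem_coe.1 hxX)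
  obtain ⟨J, hJ, hJt⟩ := exists_cover_of_isBasis hI hlt
  have hc := card_eq_of_isTight_cover hIX hJ hJt
  refine ⟨J, by omega, ?_⟩
  rw [Set.ncard_coe_finset]
  have h1 := Finset.card_sdiff_add_card_eq_card hXE'
  have h2 := Finset.card_le_card_sdiff_add_card (s := Finset.univ.biUnion f \ X)
    (t := J.biUnion f)
  unfold gain at hc
  omega

theorem exists_isParamMatroid (f : Fin m → Finset α) {n k r δ D : ℤ} (h : HasPrivateParts f η)
    (hk : 0 < k) (hrk : r < k) (hδ : 2 ≤ δ) (hη : ∀ j, δ - 1 ≤ η j)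
    (hr : ∀ j, ((f j).card : ℤ) - η j ≤ r) (hn : ((Finset.univ.biUnion f).card : ℤ) = n)
    (hku : k ≤ gain f η Finset.univ) (hD : ∀ J, gain f η J < k → ∑ i ∈ J, η i ≤ D)
    (hD' : ∃ J, gain f η J < k ∧ ∑ i ∈ J, η i = D) :
    ∃ M : Matroid α, IsAtomicMatroid M ∧ IsParamMatroid M n k (n - k + 1 - D) r δ := by
  have hη0 : ∀ j, 0 < η j := fun j ↦ by linarith [hη j]
  have hη0' : ∀ j, 0 ≤ η j := fun j ↦ (hη0 j).le
  set M := atomMatroid f η k hk.le h with hM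
  have hME : M.E = ↑(Finset.univ.biUnion f) := rfl
  have hatoms := isMatroidOfAtoms_atomMatroid (hk := hk.le) (h := h) hη0
    (ρ := fun j ↦ (f j).card - η j) (fun _ ↦ rfl) hku
  have hrank : rankZ M M.E = k := hatoms.rank_ground
  have hlower : ∀ X, M✶.IsCircuit X → n - k + 1 - D ≤ X.ncard := fun X hX ↦ by
    obtain ⟨J, hJ, hJX⟩ := card_add_le_of_dual_circuit hX
    linarith [hD J hJ]
  refine ⟨M, ⟨m, _, fun j ↦ f j, k, _, ⟨Finset.finite_toSet _, hk, fun j ↦ ?_, atomUnion_coe _,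
    ?_, fun j ↦ ?_⟩, hatoms⟩, Finset.finite_toSet _, ?_, hrank, ⟨?_, ?_⟩, fun x hx ↦ ?_⟩
  · have h1 := h j ∅ (by simp)
    simp only [Finset.biUnion_empty, Finset.sdiff_empty] at h1
    rw [Set.ncard_coe_finset]
    exact ⟨by linarith, by linarith [hη0 j]⟩
  · rwa [unionRank_coe fun _ ↦ rfl]
  · have h1 := h j (Finset.univ \ {j}) (by simp)
    have h2 := Finset.card_sdiff_add_card_inter (f j) ((Finset.univ \ {j}).biUnion f)
    rw [atomUnion_coe, ← Finset.coe_inter, Set.ncard_coe_finset, Finset.inter_comm]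
    omega
  · rw [hME, Set.ncard_coe_finset, hn]
  · obtain ⟨J, hJ, hJD⟩ := hD'
    have hJr : rankZ M ↑(J.biUnion f) = gain f η J := by
      rw [hM, rankZ_biUnion hη0', min_eq_right hJ.le]
    obtain ⟨X, hX, hXcard⟩ := exists_cocircuit_ncard_le (M := M) (Finset.finite_toSet _)
      (F := ↑(J.biUnion f)) (Finset.coe_subset.2 (biUnion_subset_univ J)) (by omega)
    refine ⟨X, hX, ?_⟩
    have := hlower X hX
    rw [hME, Set.ncard_coe_finset, ← hME, hrank, hJr, hn, Set.ncard_coe_finset, gain] at hXcard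
    omega
  · rintro t ⟨X, hX, rfl⟩
    exact hlower X hX
  · rw [hME, Finset.mem_coe, Finset.mem_biUnion] at hx
    obtain ⟨j, -, hxj⟩ := hx
    have hg := (gain_strictMono h) (Finset.empty_ssubset_singleton (a := j))
    rw [gain_empty] at hg
    have hgj := gain_singleton (f := f) (η := η) j
    have := hη j
    have := hr j
    obtain ⟨S, hxS, hSj, hS⟩ := Finset.exists_subsuperset_card_eq
      (s := {x}) (t := f j) (n := (gain f η {j} + δ - 1).toNat)
      (Finset.singleton_subset_iff.2 hxj) (by rw [Finset.card_singleton]; omega) (by omega)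
    exact ⟨S, Finset.mem_coe.2 (hxS (Finset.mem_singleton_self x)),
      isLocalitySet_of_subset_atom hSj (by omega) (by omega) (by omega)⟩

end FinsetAtoms

/-! ### What locality forces on the atoms of a member of the class. -/

section rankZ

variable {α : Type*} {M : Matroid α} {X Y : Set α}

lemma coe_toNat_eRk (hM : M.E.Finite) (X : Set α) : ((M.eRk X).toNat : ℕ∞) = M.eRk X := by
  refine ENat.natCast_toNat (ne_top_of_le_ne_top ?_
    ((M.eRk_le_eRank X).trans M.eRank_le_encard_ground))
  exact hM.encard_lt_top.ne

lemma rankZ_mono (hM : M.E.Finite) (hXY : X ⊆ Y) : rankZ M X ≤ rankZ M Y := by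
  have h := M.eRk_mono hXY
  rw [← coe_toNat_eRk hM X, ← coe_toNat_eRk hM Y] at h
  unfold rankZ
  exact_mod_cast h

lemma rankZ_union_le (hM : M.E.Finite) (X : Set α) (hY : Y.Finite) :
    rankZ M (X ∪ Y) ≤ rankZ M X + Y.ncard := by
  have h := M.eRk_union_le_eRk_add_encard X Y
  rw [← coe_toNat_eRk hM, ← coe_toNat_eRk hM X, ← hY.cast_ncard_eq] at h
  unfold rankZ
  exact_mod_cast h

lemma rankZ_le_ncard (hM : M.E.Finite) (hY : Y.Finite) : rankZ M Y ≤ Y.ncard := by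
  have h := rankZ_union_le hM ∅ hY
  simpa [rankZ] using h

lemma rankZ_closure (X : Set α) : rankZ M (M.closure X) = rankZ M X := by
  simp [rankZ]

lemma subset_closure_of_rankZ_le (hM : M.E.Finite) (hX : X ⊆ Y) (hY : Y ⊆ M.E)
    (h : rankZ M Y ≤ rankZ M X) : Y ⊆ M.closure X := by
  have h1 : M.eRk Y ≤ M.eRk X := by
    rw [← coe_toNat_eRk hM, ← coe_toNat_eRk hM X]
    unfold rankZ at h
    exact_mod_cast h
  have hfin : M.IsRkFinite X := by
    rw [← Matroid.eRk_ne_top_iff, ← coe_toNat_eRk hM]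
    exact ENat.natCast_ne_top _
  rw [hfin.closure_eq_closure_of_subset_of_eRk_ge_eRk hX h1]
  exact M.subset_closure Y hY

end rankZ

section locality

variable {α : Type*} {M : Matroid α} {r δ : ℤ} {S : Set α}

/-- A set Y of smaller rank contains no basis of S, so S \ Y meets every basis and contains a
cocircuit of the restriction. -/
lemma IsLocalitySet.le_ncard_diff (hS : IsLocalitySet M r δ S) (hM : M.E.Finite) {Y : Set α}
    (hlt : rankZ M Y < rankZ M S) : δ ≤ (S \ Y).ncard := by
  have hdep : (M ↾ S)✶.Dep (S \ Y) := by
    rw [Matroid.dual_dep_iff_forall]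
    refine ⟨fun B hB ↦ ?_, Set.sdiff_subset⟩
    rw [Matroid.isBase_restrict_iff hS.1] at hB
    by_contra hne
    rw [Set.not_nonempty_iff_eq_empty] at hne
    have hBY : B ⊆ Y := fun x hx ↦ by
      by_contra hxY
      exact Set.notMem_empty x (hne ▸ ⟨⟨hB.subset hx, hxY⟩, hx⟩)
    have h1 : rankZ M B = rankZ M S := by rw [rankZ, hB.eRk_eq_eRk, rankZ]
    linarith [rankZ_mono (M := M) hM hBY]
  obtain ⟨C, hCS, hC⟩ := hdep.exists_isCircuit_subset
  have h1 := hS.2.2 C hC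
  have h2 := Set.ncard_le_ncard hCS ((hM.subset hS.1).subset Set.sdiff_subset)
  omega

lemma IsLocalitySet.rank_le (hS : IsLocalitySet M r δ S) (hM : M.E.Finite)
    (hpos : 0 < rankZ M S) : rankZ M S ≤ S.ncard - δ + 1 := by
  have hSfin := hM.subset hS.1
  obtain ⟨B, hB⟩ := M.exists_isBasis S hS.1
  have hBfin := hSfin.subset hB.subset
  have hBr : rankZ M S = B.ncard := by rw [rankZ, hB.eRk_eq_encard, Set.ncard_def]
  have hne : B.Nonempty := by
    rw [Set.nonempty_iff_ne_empty]
    rintro rfl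
    simp at hBr
    omega
  obtain ⟨e, he⟩ := hne
  have h1 := Set.ncard_sdiff_singleton_add_one he hBfin
  have h2 := rankZ_le_ncard hM (hBfin.subset (Set.sdiff_subset (t := {e})))
  have h3 := hS.le_ncard_diff hM (Y := B \ {e}) (by omega)
  have h4 := Set.ncard_sdiff_add_ncard_of_subset (Set.sdiff_subset.trans hB.subset) hSfin
    (s := B \ {e})
  omega

/-- As δ ≥ 2, the restriction to S has no coloop; elements of the closure outside S are spanned by
S. -/
lemma IsLocalitySet.isCyclicFlat_closure (hS : IsLocalitySet M r δ S) (hM : M.E.Finite)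
    (hδ : 2 ≤ δ) : IsCyclicFlat M (M.closure S) := by
  refine ⟨Matroid.isFlat_closure S, isCyclicSet_of_forall_mem_closure fun e he ↦ ?_⟩
  by_cases heS : e ∈ S
  · have h1 : S ⊆ M.closure (S \ {e}) := by
      refine subset_closure_of_rankZ_le hM Set.sdiff_subset hS.1 ?_
      by_contra! hlt
      have h2 := hS.le_ncard_diff hM hlt
      have h3 : (S \ (S \ {e})).ncard ≤ ({e} : Set α).ncard :=
        Set.ncard_le_ncard (fun x hx ↦ by
          by_contra hxe
          exact hx.2 ⟨hx.1, hxe⟩) (Set.finite_singleton e)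
      rw [Set.ncard_singleton] at h3
      omega
    exact M.closure_subset_closure
      (Set.sdiff_subset_sdiff_left (M.subset_closure S hS.1)) (h1 heS)
  · have hsub : S ⊆ M.closure S \ {e} := fun x hx ↦
      ⟨M.subset_closure S hS.1 hx, fun hxe ↦ heS (Set.mem_singleton_iff.1 hxe ▸ hx)⟩
    exact M.closure_subset_closure hsub he

end locality

namespace FinsetAtoms

variable {α : Type*} [DecidableEq α] {m : ℕ}

/-- An atom system is given by finsets. -/
lemma exists_finset_atoms {E : Set α} {F : Fin m → Set α} {k : ℤ} {ρ : Fin m → ℤ}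
    (hF : IsAtomSystem E F k ρ) : ∃ (f : Fin m → Finset α) (η : Fin m → ℤ),
      (F = fun j ↦ (f j : Set α)) ∧ (∀ j, ρ j = (f j).card - η j) ∧ (∀ j, 0 < η j) ∧
      HasPrivateParts f η ∧ E = ↑(Finset.univ.biUnion f) ∧ k ≤ gain f η Finset.univ := by
  have hfin : ∀ j, (F j).Finite := fun j ↦ hF.finite.subset <| by
    rw [← hF.union_eq]
    exact Set.subset_biUnion_of_mem (u := F) (Finset.mem_univ j)
  lift F to Fin m → Finset α using hfin
  refine ⟨F, fun j ↦ (F j).card - ρ j, rfl, fun j ↦ by ring, fun j ↦ ?_, fun j J hj ↦ ?_, ?_, ?_⟩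
  · have := (hF.pos_lt j).2
    rw [Set.ncard_coe_finset] at this
    linarith
  · have h1 := hF.inter_lt j
    rw [atomUnion_coe, ← Finset.coe_inter, Set.ncard_coe_finset] at h1
    have h2 : (F j ∩ J.biUnion F).card ≤ ((Finset.univ \ {j}).biUnion F ∩ F j).card := by
      apply Finset.card_le_card
      rw [Finset.inter_comm]
      refine Finset.inter_subset_inter_right (Finset.biUnion_subset_biUnion_of_subset_left F ?_)
      intro i hi
      simp only [Finset.mem_sdiff, Finset.mem_univ, Finset.mem_singleton, true_and]
      rintro rfl
      exact hj hi
    have h3 := Finset.card_sdiff_add_card_inter (F j) (J.biUnion F)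
    dsimp only
    omega
  · rw [← hF.union_eq, atomUnion_coe]
  · have := hF.k_le
    rwa [unionRank_coe (η := fun j ↦ (F j).card - ρ j) (fun _ ↦ by ring)] at this

variable {f : Fin m → Finset α} {η ρ : Fin m → ℤ} {k r δ : ℤ} {M : Matroid α}

/-- Take a private element x of F_j and a locality set S containing it. The closure of S is a cyclic
flat of rank at most r < k, hence some F_J, and x forces j ∈ J. So gain {j} ≤ gain J ≤ r. The
nullity bound comes from a large subset of S of smaller rank. -/
theorem locality_bounds (h : HasPrivateParts f η) (hη : ∀ j, 0 < η j)
    (hρ : ∀ j, ρ j = (f j).card - η j) (hk : 0 < k)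
    (hM : IsMatroidOfAtoms M ↑(Finset.univ.biUnion f) (fun j ↦ (f j : Set α)) k ρ)
    (hrk : r < k) (hδ : 2 ≤ δ) (hloc : ∀ j ∈ M.E, ∃ S : Set α, j ∈ S ∧ IsLocalitySet M r δ S)
    (j : Fin m) : ((f j).card : ℤ) - η j ≤ r ∧ δ - 1 ≤ η j := by
  have hsmall : ∀ J, IsSmallIndexSet (fun j ↦ (f j : Set α)) k ρ J ↔ gain f η J < k :=
    fun J ↦ isSmallIndexSet_coe_iff hρ h
  have hrank : ∀ J, gain f η J < k → rankZ M ↑(J.biUnion f) = gain f η J := fun J hJ ↦ by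
    have := hM.rank_small J ((hsmall J).2 hJ)
    rwa [unionRank_coe hρ, atomUnion_coe] at this
  have hcyc := hM.cyclicFlat_iff
  simp only [hsmall, atomUnion_coe] at hcyc
  have hMfin : M.E.Finite := by
    rw [hM.ground_eq]
    exact Finset.finite_toSet _
  have hpriv := h j (Finset.univ.erase j) (by simp)
  have hmono := gain_strictMono h
  obtain ⟨x, hx⟩ : (f j \ (Finset.univ.erase j).biUnion f).Nonempty := by
    rw [← Finset.card_pos]
    have := hη j
    omega
  rw [Finset.mem_sdiff] at hx
  have hxonly : ∀ i, x ∈ f i → i = j := fun i hi ↦ by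
    by_contra hij
    exact hx.2 (Finset.mem_biUnion.2 ⟨i, by simp [hij], hi⟩)
  have hxE : x ∈ M.E := by
    rw [hM.ground_eq]
    exact Finset.mem_coe.2 (Finset.mem_biUnion.2 ⟨j, Finset.mem_univ j, hx.1⟩)
  obtain ⟨S, hxS, hS⟩ := hloc x hxE
  have hSfin : S.Finite := hMfin.subset hS.1
  have hSpos : 0 < rankZ M S := by
    have hflat : IsCyclicFlat M ∅ := (hcyc ∅).2 (Or.inl ⟨∅, by rwa [gain_empty], by simp⟩)
    by_contra! hle
    have h1 := subset_closure_of_rankZ_le hMfin (Set.empty_subset S) hS.1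
      (hle.trans (by simp [rankZ]))
    rw [hflat.1.closure] at h1
    exact h1 hxS
  have hSr := hS.rank_le hMfin hSpos
  have hScard := hS.2.1
  have hrankE := hM.rank_ground
  obtain ⟨J, hJ, hcl⟩ : ∃ J, gain f η J < k ∧ M.closure S = ↑(J.biUnion f) := by
    rcases (hcyc _).1 (hS.isCyclicFlat_closure hMfin hδ) with h1 | h1
    · exact h1
    · rw [← h1, rankZ_closure] at hrankE
      omega
  have hSJ : S ⊆ ↑(J.biUnion f) := hcl ▸ M.subset_closure S hS.1
  have hSrank : rankZ M S = gain f η J := by rw [← rankZ_closure, hcl, hrank J hJ]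
  have hjJ : j ∈ J := by
    obtain ⟨i, hi, hxi⟩ := Finset.mem_biUnion.1 (Finset.mem_coe.1 (hSJ hxS))
    exact hxonly i hxi ▸ hi
  have hj1 := hmono.monotone (Finset.singleton_subset_iff.2 hjJ)
  rw [gain_singleton] at hj1
  refine ⟨by omega, ?_⟩
  lift S to Finset α using hSfin
  rw [Finset.coe_subset] at hSJ
  set W := (J.erase j).biUnion f with hW
  have hgJ := gain_insert (f := f) (η := η) (Finset.notMem_erase j J)
  rw [Finset.insert_erase hjJ, ← hW] at hgJ
  have hDpos := h j (J.erase j) (Finset.notMem_erase j J)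
  rw [← hW] at hDpos
  have hWr := hrank (J.erase j) ((hmono.monotone (Finset.erase_subset j J)).trans_lt hJ)
  rw [← hW] at hWr
  have hSW : S \ W ⊆ f j \ W := by
    intro y hy
    rw [Finset.mem_sdiff] at hy ⊢
    refine ⟨?_, hy.2⟩
    obtain ⟨i, hi, hyi⟩ := Finset.mem_biUnion.1 (hSJ hy.1)
    by_cases hij : i = j
    · exact hij ▸ hyi
    · exact absurd (Finset.mem_biUnion.2 ⟨i, Finset.mem_erase.2 ⟨hij, hi⟩, hyi⟩) hy.2
  have hSWcard := Finset.card_le_card hSW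
  have hrankle : ∀ A : Finset α,
      rankZ M (↑(S ∩ W) ∪ ↑A) ≤ gain f η (J.erase j) + A.card := fun A ↦ by
    have h1 := rankZ_union_le hMfin ↑(S ∩ W) A.finite_toSet
    have h2 := rankZ_mono hMfin (Finset.coe_subset.2 (Finset.inter_subset_right (s₁ := S) (s₂ := W)))
    rw [Set.ncard_coe_finset] at h1
    omega
  -- With W the union of the atoms of J other than F_j, the rank of S is gain (J \ {j}) + |F_j \ W|
  -- - η_j. The size of A keeps (S ∩ W) ∪ A one below this, so at least δ elements of S remain,
  -- while at most η_j + 1 can.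
  obtain ⟨A, hA, hAcard⟩ := Finset.exists_subset_card_eq (s := S \ W)
    (n := min (S \ W).card (((f j \ W).card : ℤ) - η j - 1).toNat) (min_le_left _ _)
  have hAr := hrankle A
  rw [← Finset.coe_union] at hAr
  have hsub : S ∩ W ∪ A ⊆ S :=
    Finset.union_subset Finset.inter_subset_left (hA.trans Finset.sdiff_subset)
  have hle := hS.le_ncard_diff hMfin (Y := ↑(S ∩ W ∪ A)) (by omega)
  have heq : S \ (S ∩ W ∪ A) = (S \ W) \ A := by
    ext y
    simp only [Finset.mem_sdiff, Finset.mem_union, Finset.mem_inter]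
    tauto
  rw [← Finset.coe_sdiff, Set.ncard_coe_finset, heq] at hle
  have h5 := Finset.card_sdiff_add_card_eq_card hA
  omega

theorem dist_le_of_gain_lt {n d : ℤ} (h : HasPrivateParts f η)
    (hρ : ∀ j, ρ j = (f j).card - η j)
    (hM : IsMatroidOfAtoms M ↑(Finset.univ.biUnion f) (fun j ↦ (f j : Set α)) k ρ)
    (hp : IsParamMatroid M n k d r δ) {J : Finset (Fin m)} (hJ : gain f η J < k) :
    d ≤ n - k + 1 - ∑ i ∈ J, η i := by
  have hJr : rankZ M ↑(J.biUnion f) = gain f η J := by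
    have := hM.rank_small J ((isSmallIndexSet_coe_iff hρ h).2 hJ)
    rwa [unionRank_coe hρ, atomUnion_coe] at this
  obtain ⟨X, hX, hXcard⟩ := exists_cocircuit_ncard_le hp.finite (F := ↑(J.biUnion f))
    (by rw [hM.ground_eq]; exact Finset.coe_subset.2 (biUnion_subset_univ J))
    (by rw [hJr, hp.rank_eq]; exact hJ)
  have hd := hp.dist.2 ⟨X, hX, rfl⟩
  rw [hp.rank_eq, hp.card_eq, hJr, Set.ncard_coe_finset, gain] at hXcard
  linarith

end FinsetAtoms

/-! ### Adjusting a family of atoms to a prescribed number of elements. -/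

namespace FinsetAtoms

variable {β : Type u} [DecidableEq β] {s t : ℕ} {f : Fin s → Finset β} {R c δ : ℤ}

/-- A family of sets of size at most `R`, each with at least `δ` private elements, such that any
`t` of them cover at least `c` elements. -/
structure IsSpread (f : Fin s → Finset β) (R δ c : ℤ) (t : ℕ) : Prop where
  card_le : ∀ j, ((f j).card : ℤ) ≤ R
  le_private : ∀ j, δ ≤ (f j \ (Finset.univ.erase j).biUnion f).card
  le_card : ∀ J : Finset (Fin s), J.card = t → c ≤ (J.biUnion f).card

/-- The set A is either f i itself, when there is room, or f i without one element shared with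
another atom. The fresh y compensates for that loss in every union, and no private element is lost.
-/
lemma IsSpread.update (hf : IsSpread f R δ c t) {i : Fin s} {A : Finset β} {y : β} (hA : A ⊆ f i)
    (hcard : (A.card : ℤ) < R) (hdiff : f i \ A ⊆ (Finset.univ.erase i).biUnion f)
    (hone : (f i \ A).card ≤ 1) (hy : y ∉ Finset.univ.biUnion f) :
    IsSpread (Function.update f i (insert y A)) R δ c t ∧
      Finset.univ.biUnion (Function.update f i (insert y A)) =
        insert y (Finset.univ.biUnion f) := by
  have hyf : ∀ j, y ∉ f j := fun j hj ↦ hy (Finset.mem_biUnion.2 ⟨j, Finset.mem_univ j, hj⟩)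
  set f' := Function.update f i (insert y A) with hf'
  have hi : f' i = insert y A := Function.update_self ..
  have hne : ∀ j, j ≠ i → f' j = f j := fun j hj ↦ Function.update_of_ne hj ..
  have hsub : ∀ j, f' j ⊆ insert y (f j) := fun j ↦ by
    by_cases hj : j = i
    · rw [hj, hi]
      exact Finset.insert_subset_insert y hA
    · rw [hne j hj]
      exact Finset.subset_insert y _
  have hothers : (Finset.univ.erase i).biUnion f' = (Finset.univ.erase i).biUnion f :=
    Finset.biUnion_congr rfl fun j hj ↦ hne j (Finset.ne_of_mem_erase hj)
  refine ⟨⟨fun j ↦ ?_, fun j ↦ ?_, fun J hJ ↦ ?_⟩, ?_⟩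
  · by_cases hj : j = i
    · rw [hj, hi]
      have := Finset.card_insert_le y A
      omega
    · rw [hne j hj]
      exact hf.card_le j
  · refine (hf.le_private j).trans ?_
    norm_cast
    apply Finset.card_le_card
    by_cases hj : j = i
    · rw [hj, hi, hothers]
      intro x hx
      rw [Finset.mem_sdiff] at hx ⊢
      refine ⟨Finset.mem_insert_of_mem ?_, hx.2⟩
      by_contra hxA
      exact hx.2 (hdiff (Finset.mem_sdiff.2 ⟨hx.1, hxA⟩))
    · rw [hne j hj]
      intro x hx
      rw [Finset.mem_sdiff] at hx ⊢
      refine ⟨hx.1, fun hx' ↦ hx.2 ?_⟩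
      obtain ⟨l, hl, hxl⟩ := Finset.mem_biUnion.1 hx'
      rcases Finset.mem_insert.1 (hsub l hxl) with rfl | h1
      · exact absurd hx.1 (hyf j)
      · exact Finset.mem_biUnion.2 ⟨l, hl, h1⟩
  · refine (hf.le_card J hJ).trans ?_
    norm_cast
    by_cases hiJ : i ∈ J
    · have hyJ : y ∈ J.biUnion f' :=
        Finset.mem_biUnion.2 ⟨i, hiJ, hi ▸ Finset.mem_insert_self y A⟩
      have h1 : J.biUnion f ⊆ (J.biUnion f').erase y ∪ (f i \ A) := by
        intro x hx
        obtain ⟨l, hl, hxl⟩ := Finset.mem_biUnion.1 hx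
        have hxy : x ≠ y := fun hxy ↦ hyf l (hxy ▸ hxl)
        rw [Finset.mem_union, Finset.mem_erase, Finset.mem_sdiff]
        by_cases hli : l = i
        · by_cases hxA : x ∈ A
          · exact Or.inl ⟨hxy, Finset.mem_biUnion.2
              ⟨i, hiJ, hi ▸ Finset.mem_insert_of_mem hxA⟩⟩
          · exact Or.inr ⟨hli ▸ hxl, hxA⟩
        · exact Or.inl ⟨hxy, Finset.mem_biUnion.2 ⟨l, hl, (hne l hli).symm ▸ hxl⟩⟩
      have h2 := Finset.card_le_card h1
      have h3 := Finset.card_union_le ((J.biUnion f').erase y) (f i \ A)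
      have h4 := Finset.card_erase_add_one hyJ
      omega
    · refine (Finset.card_le_card (Finset.Subset.antisymm_iff.1
        (Finset.biUnion_congr rfl fun j hj ↦ ?_)).1)
      rw [hne j]
      rintro rfl
      exact hiJ hj
  · ext x
    constructor
    · intro hx
      obtain ⟨l, hl, hxl⟩ := Finset.mem_biUnion.1 hx
      rcases Finset.mem_insert.1 (hsub l hxl) with h1 | h1
      · exact Finset.mem_insert.2 (Or.inl h1)
      · exact Finset.mem_insert_of_mem (Finset.mem_biUnion.2 ⟨l, hl, h1⟩)
    · intro hx
      rcases Finset.mem_insert.1 hx with rfl | hx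
      · exact Finset.mem_biUnion.2 ⟨i, Finset.mem_univ i, hi ▸ Finset.mem_insert_self _ A⟩
      · by_cases hxo : x ∈ (Finset.univ.erase i).biUnion f
        · rw [← hothers] at hxo
          exact Finset.biUnion_subset_biUnion_of_subset_left f' (Finset.subset_univ _) hxo
        · obtain ⟨l, hl, hxl⟩ := Finset.mem_biUnion.1 hx
          have hli : l = i := by
            by_contra hli
            exact hxo (Finset.mem_biUnion.2 ⟨l, by simp [hli], hxl⟩)
          have hxA : x ∈ A := by
            by_contra hxA
            exact hxo (hdiff (Finset.mem_sdiff.2 ⟨hli ▸ hxl, hxA⟩))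
          exact Finset.mem_biUnion.2 ⟨i, Finset.mem_univ i, hi ▸ Finset.mem_insert_of_mem hxA⟩

/-- Both kinds of update fail only when all sets have size R and are pairwise disjoint, but then
they cover s * R elements. -/
lemma IsSpread.exists_card_succ [Infinite β] (hf : IsSpread f R δ c t)
    (hlt : ((Finset.univ.biUnion f).card : ℤ) < s * R) :
    ∃ f' : Fin s → Finset β, IsSpread f' R δ c t ∧
      (Finset.univ.biUnion f').card = (Finset.univ.biUnion f).card + 1 := by
  obtain ⟨y, hy⟩ := Infinite.exists_notMem_finset (Finset.univ.biUnion f)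
  suffices h : ∃ (i : Fin s) (A : Finset β), A ⊆ f i ∧ (A.card : ℤ) < R ∧
      f i \ A ⊆ (Finset.univ.erase i).biUnion f ∧ (f i \ A).card ≤ 1 by
    obtain ⟨i, A, h1, h2, h3, h4⟩ := h
    obtain ⟨h5, h6⟩ := hf.update h1 h2 h3 h4 hy
    exact ⟨_, h5, by rw [h6, Finset.card_insert_of_notMem hy]⟩
  by_cases hfull : ∃ i, ((f i).card : ℤ) < R
  · obtain ⟨i, hi⟩ := hfull
    exact ⟨i, f i, subset_rfl, hi, by simp, by simp⟩
  push Not at hfull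
  have hcard : ∀ i, ((f i).card : ℤ) = R := fun i ↦ le_antisymm (hf.card_le i) (hfull i)
  obtain ⟨i, x, hxi, hx⟩ : ∃ i, ∃ x ∈ f i, x ∈ (Finset.univ.erase i).biUnion f := by
    by_contra! hcon
    have h1 : (Finset.univ.biUnion f).card = ∑ i, (f i).card := by
      refine Finset.card_biUnion fun i _ j _ hij ↦ Finset.disjoint_left.2 fun x hxi hxj ↦ ?_
      exact hcon i x hxi (Finset.mem_biUnion.2 ⟨j, by simp [hij.symm], hxj⟩)
    rw [h1] at hlt
    push_cast at hlt
    simp [hcard] at hlt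
  refine ⟨i, (f i).erase x, Finset.erase_subset x _, ?_, ?_, ?_⟩
  · have h1 := Finset.card_erase_add_one hxi
    have := hcard i
    omega
  · rw [Finset.sdiff_erase_self hxi]
    exact Finset.singleton_subset_iff.2 hx
  · rw [Finset.sdiff_erase_self hxi, Finset.card_singleton]

lemma IsSpread.exists_card_eq [Infinite β] (hf : IsSpread f R δ c t) {n : ℤ}
    (hn : ((Finset.univ.biUnion f).card : ℤ) ≤ n) (hnR : n ≤ s * R) :
    ∃ f' : Fin s → Finset β, IsSpread f' R δ c t ∧
      ((Finset.univ.biUnion f').card : ℤ) = n := by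
  obtain ⟨l, hl⟩ := Int.le.dest hn
  induction l generalizing f with
  | zero => exact ⟨f, hf, by simpa using hl⟩
  | succ l ih =>
    push_cast at hl
    obtain ⟨f', hf', hcard⟩ := hf.exists_card_succ (by omega)
    exact ih hf' (by omega) (by omega)

lemma card_biUnion_le_sum (f : Fin s → Finset β) (J : Finset (Fin s)) :
    ((J.biUnion f).card : ℤ) ≤ ∑ j ∈ J, ((f j).card : ℤ) := by
  exact_mod_cast Finset.card_biUnion_le

lemma gain_le_sum (η : Fin s → ℤ) (J : Finset (Fin s)) :
    gain f η J ≤ ∑ j ∈ J, (((f j).card : ℤ) - η j) := by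
  rw [gain, Finset.sum_sub_distrib]
  linarith [card_biUnion_le_sum f J]

lemma gain_le_mul {η : Fin s → ℤ} {r : ℤ} (hr : ∀ j, ((f j).card : ℤ) - η j ≤ r)
    (J : Finset (Fin s)) : gain f η J ≤ J.card * r := by
  refine (gain_le_sum η J).trans ?_
  have := Finset.sum_le_card_nsmul J (fun j ↦ ((f j).card : ℤ) - η j) r fun j _ ↦ hr j
  simpa using this

lemma card_lt_of_gain_lt {η : Fin s → ℤ} {k : ℤ} (h : HasPrivateParts f η)
    (ht : ∀ J : Finset (Fin s), J.card = t → k ≤ gain f η J) {J : Finset (Fin s)}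
    (hJ : gain f η J < k) : J.card < t := by
  by_contra! hle
  obtain ⟨K, hK, hKt⟩ := Finset.exists_subset_card_eq hle
  linarith [ht K hKt, (gain_strictMono h).monotone hK]

/-- With all nullities δ-1, the value c = k + t(δ-1) makes the gain of any t atoms at least k. So at
most t-1 atoms fit below rank k, and t-1 do fit since (t-1)r < k. -/
theorem IsSpread.exists_isParamMatroid [Infinite β] {n k r : ℤ}
    (hf : IsSpread f (r + δ - 1) δ (k + t * (δ - 1)) t) (hk : 0 < k) (hrk : r < k) (hδ : 2 ≤ δ)
    (ht : 1 ≤ t) (hts : t ≤ s) (htr : ((t : ℤ) - 1) * r < k)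
    (hn : ((Finset.univ.biUnion f).card : ℤ) ≤ n) (hnR : n ≤ s * (r + δ - 1)) :
    ∃ M : Matroid β, IsAtomicMatroid M ∧
      IsParamMatroid M n k (n - k + 1 - ((t : ℤ) - 1) * (δ - 1)) r δ := by
  obtain ⟨f, hf, hcard⟩ := hf.exists_card_eq hn hnR
  have h : HasPrivateParts f fun _ ↦ δ - 1 := fun j J hj ↦ by
    have h1 := hf.le_private j
    have h2 : (f j \ (Finset.univ.erase j).biUnion f).card ≤ (f j \ J.biUnion f).card := by
      refine Finset.card_le_card (Finset.sdiff_subset_sdiff subset_rfl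
        (Finset.biUnion_subset_biUnion_of_subset_left f fun i hi ↦ ?_))
      simp only [Finset.mem_erase, Finset.mem_univ, and_true]
      rintro rfl
      exact hj hi
    show δ - 1 < _
    omega
  have hr : ∀ j, ((f j).card : ℤ) - (δ - 1) ≤ r := fun j ↦ by linarith [hf.card_le j]
  have hge : ∀ J : Finset (Fin s), J.card = t → k ≤ gain f (fun _ ↦ δ - 1) J := fun J hJ ↦ by
    have := hf.le_card J hJ
    rw [gain, Finset.sum_const, hJ, nsmul_eq_mul]
    linarith
  have hex : ∀ l ≤ s, ∃ J : Finset (Fin s), J.card = l := fun l hl ↦ by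
    obtain ⟨J, -, hJ⟩ := Finset.exists_subset_card_eq
      (s := (Finset.univ : Finset (Fin s))) (n := l) (by simpa using hl)
    exact ⟨J, hJ⟩
  refine FinsetAtoms.exists_isParamMatroid f h hk hrk hδ (fun _ ↦ le_rfl) hr hcard ?_
    (fun J hJ ↦ ?_) ?_
  · obtain ⟨J, hJ⟩ := hex t hts
    exact (hge J hJ).trans ((gain_strictMono h).monotone (Finset.subset_univ J))
  · have := card_lt_of_gain_lt h hge hJ
    rw [Finset.sum_const, nsmul_eq_mul]
    exact mul_le_mul_of_nonneg_right (by omega) (by omega)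
  · obtain ⟨J, hJ⟩ := hex (t - 1) (by omega)
    have hJ' : (J.card : ℤ) = (t : ℤ) - 1 := by omega
    refine ⟨J, ?_, by rw [Finset.sum_const, nsmul_eq_mul, hJ']⟩
    have := gain_le_mul hr J
    rw [hJ'] at this
    omega

variable {α : Type u} [DecidableEq α]

/-- Deleting private elements lowers all nullities to `δ - 1`. -/
lemma exists_isSpread {f : Fin s → Finset α} {η : Fin s → ℤ} {r k : ℤ}
    (h : HasPrivateParts f η) (hδ : 2 ≤ δ) (hη : ∀ j, δ - 1 ≤ η j)
    (hr : ∀ j, ((f j).card : ℤ) - η j ≤ r)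
    (ht : ∀ J : Finset (Fin s), J.card = t → k ≤ gain f η J) :
    ∃ f' : Fin s → Finset α, IsSpread f' (r + δ - 1) δ (k + t * (δ - 1)) t ∧
      (Finset.univ.biUnion f').card ≤ (Finset.univ.biUnion f).card := by
  have hV : ∀ j, ∃ V ⊆ f j \ (Finset.univ.erase j).biUnion f,
      V.card = (η j - (δ - 1)).toNat := fun j ↦ by
    refine Finset.exists_subset_card_eq ?_
    have := h j (Finset.univ.erase j) (by simp)
    have := hη j
    omega
  choose V hVsub hVcard using hV
  -- More than η j elements of f j are private, so at least δ survive the removal of η j - (δ - 1)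
  -- of them.
  refine ⟨fun j ↦ f j \ V j, ⟨fun j ↦ ?_, fun j ↦ ?_, fun J hJ ↦ ?_⟩, ?_⟩
  · have h1 := Finset.card_sdiff_add_card_eq_card ((hVsub j).trans Finset.sdiff_subset)
    have := hVcard j
    have := hη j
    have := hr j
    omega
  · have h1 : (f j \ (Finset.univ.erase j).biUnion f) \ V j ⊆
        (f j \ V j) \ (Finset.univ.erase j).biUnion fun i ↦ f i \ V i := by
      intro x hx
      simp only [Finset.mem_sdiff, Finset.mem_biUnion, not_exists, not_and] at hx ⊢
      exact ⟨⟨hx.1.1, hx.2⟩, fun i hi hxi ↦ absurd hxi (hx.1.2 i hi)⟩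
    have h2 := Finset.card_le_card h1
    have h3 := Finset.card_sdiff_add_card_eq_card (hVsub j)
    have := h j (Finset.univ.erase j) (by simp)
    have := hη j
    have := hVcard j
    omega
  · have h1 : J.biUnion f ⊆ (J.biUnion fun i ↦ f i \ V i) ∪ J.biUnion V := by
      intro x hx
      obtain ⟨l, hl, hxl⟩ := Finset.mem_biUnion.1 hx
      by_cases hxV : x ∈ V l
      · exact Finset.mem_union_right _ (Finset.mem_biUnion.2 ⟨l, hl, hxV⟩)
      · exact Finset.mem_union_left _
          (Finset.mem_biUnion.2 ⟨l, hl, Finset.mem_sdiff.2 ⟨hxl, hxV⟩⟩)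
    have h2 := (Finset.card_le_card h1).trans (Finset.card_union_le _ _)
    have h3 := card_biUnion_le_sum V J
    have h4 : ∑ j ∈ J, ((V j).card : ℤ) = ∑ j ∈ J, η j - t * (δ - 1) := by
      rw [← hJ, ← nsmul_eq_mul, ← Finset.sum_const, ← Finset.sum_sub_distrib]
      refine Finset.sum_congr rfl fun j _ ↦ ?_
      rw [hVcard j, Int.toNat_of_nonneg (by linarith [hη j])]
    have h5 := ht J hJ
    rw [gain] at h5
    zify at h2
    linarith
  · exact Finset.card_le_card (Finset.biUnion_mono fun j _ ↦ Finset.sdiff_subset)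

lemma IsSpread.map {f : Fin s → Finset α} (hf : IsSpread f R δ c t) (φ : α ↪ β) :
    IsSpread (fun j ↦ (f j).map φ) R δ c t ∧
      (Finset.univ.biUnion fun j ↦ (f j).map φ).card = (Finset.univ.biUnion f).card := by
  have h1 : ∀ J : Finset (Fin s), (J.biUnion fun j ↦ (f j).map φ) = (J.biUnion f).map φ :=
    fun J ↦ by
      ext x
      simp only [Finset.mem_biUnion, Finset.mem_map]
      constructor
      · rintro ⟨j, hj, y, hy, rfl⟩
        exact ⟨y, ⟨j, hj, hy⟩, rfl⟩
      · rintro ⟨y, ⟨j, hj, hy⟩, rfl⟩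
        exact ⟨j, hj, y, hy, rfl⟩
  refine ⟨⟨fun j ↦ ?_, fun j ↦ ?_, fun J hJ ↦ ?_⟩, ?_⟩
  · rw [Finset.card_map]
    exact hf.card_le j
  · rw [h1, ← Finset.map_sdiff, Finset.card_map]
    exact hf.le_private j
  · rw [h1, Finset.card_map]
    exact hf.le_card J hJ
  · rw [h1, Finset.card_map]

end FinsetAtoms

/-! ### Arithmetic of the parameters. -/

lemma ceilQuot_spec {a b : ℤ} (hb : 0 < b) :
    (ceilQuot a b - 1) * b < a ∧ a ≤ ceilQuot a b * b := by
  have hb' : (0 : ℚ) < b := by exact_mod_cast hb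
  constructor
  · have h : (ceilQuot a b : ℚ) < a / b + 1 := Int.ceil_lt_add_one _
    rw [← sub_lt_iff_lt_add, lt_div_iff₀ hb'] at h
    exact_mod_cast h
  · have h : (a : ℚ) / b ≤ ceilQuot a b := Int.le_ceil _
    rw [div_le_iff₀ hb'] at h
    exact_mod_cast h

lemma paramQ_spec {n r δ : ℤ} (hm : 0 < paramM n r δ) :
    paramQ n r δ * paramM n r δ ≤ r + δ - 1 - paramB n r δ ∧
      r + δ - 1 - paramB n r δ < (paramQ n r δ + 1) * paramM n r δ := by
  have hm' : (0 : ℚ) < paramM n r δ := by exact_mod_cast hm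
  constructor
  · have h : (paramQ n r δ : ℚ) ≤ ((r + δ - 1 - paramB n r δ : ℤ) : ℚ) / paramM n r δ :=
      Int.floor_le _
    rw [le_div_iff₀ hm'] at h
    exact_mod_cast h
  · have h : ((r + δ - 1 - paramB n r δ : ℤ) : ℚ) / paramM n r δ < (paramQ n r δ : ℚ) + 1 :=
      Int.lt_floor_add_one _
    rw [div_lt_iff₀ hm'] at h
    exact_mod_cast h

/-- The surplus nullity of `⌈k/r⌉ - 1` atoms when the leftover elements are spread evenly. -/
def surplus (n k r δ : ℤ) : ℤ :=
  (ceilQuot k r - 1) * paramQ n r δ + min (paramV n r δ) (ceilQuot k r - 1)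

lemma distBound_eq (n k r δ : ℤ) :
    distBound n k r δ =
      n - k + 1 - ((ceilQuot k r - 1) * (δ - 1) + min (δ - 1) (surplus n k r δ)) := by
  unfold distBound
  split_ifs with h
  · rw [surplus, min_eq_left h]
    ring
  · rw [surplus, min_eq_right (not_le.1 h).le]
    ring

/-- Basic facts about the parameters in the definition of `distBound`. -/
lemma param_facts {n r δ : ℤ} (hr : 0 < r) (hδ : 2 ≤ δ) (hn : r + δ - 1 < n) :
    0 < paramM n r δ ∧ 0 ≤ paramB n r δ ∧ paramB n r δ < r + δ - 1 ∧
      n = paramM n r δ * (r + δ - 1) + (r + δ - 1 - paramB n r δ) ∧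
      r + δ - 1 - paramB n r δ = paramM n r δ * paramQ n r δ + paramV n r δ ∧
      0 ≤ paramQ n r δ ∧ 0 ≤ paramV n r δ ∧ paramV n r δ < paramM n r δ := by
  have hR : 0 < r + δ - 1 := by omega
  obtain ⟨h1, h2⟩ := ceilQuot_spec (a := n) hR
  have hm : 0 < paramM n r δ := by
    unfold paramM
    by_contra! hle
    nlinarith
  obtain ⟨h3, h4⟩ := paramQ_spec hm
  have hb : paramB n r δ < r + δ - 1 := by
    unfold paramB
    linarith
  refine ⟨hm, by unfold paramB; linarith, hb, by unfold paramB paramM; ring,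
    by unfold paramV; ring, ?_, by unfold paramV; linarith, by unfold paramV; linarith⟩
  by_contra! hq
  nlinarith

/-- Take J of size u with maximal sum. Either all its values are at least q+1, or some value is at
most q; then by exchange all values outside J are at most q, leaving at least u * q + v for J. -/
lemma exists_card_eq_le_sum {s u : ℕ} (hus : u ≤ s) (e : Fin s → ℤ) {m q v : ℤ}
    (hq : 0 ≤ q) (hsm : s ≤ m) (hsum : m * q + v ≤ ∑ j, e j) :
    ∃ J : Finset (Fin s), J.card = u ∧ u * q + min v u ≤ ∑ j ∈ J, e j := by
  have hne : (Finset.powersetCard u (Finset.univ : Finset (Fin s))).Nonempty :=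
    Finset.powersetCard_nonempty.2 (by simpa using hus)
  obtain ⟨J, hJ, hmax⟩ := Finset.exists_max_image _ (fun J ↦ ∑ j ∈ J, e j) hne
  have hJu := (Finset.mem_powersetCard.1 hJ).2
  refine ⟨J, hJu, ?_⟩
  by_cases hbig : ∀ i ∈ J, q + 1 ≤ e i
  · have h1 := Finset.card_nsmul_le_sum J e (q + 1) hbig
    rw [hJu, nsmul_eq_mul] at h1
    linarith [min_le_right v (u : ℤ)]
  · push Not at hbig
    obtain ⟨i, hi, hiq⟩ := hbig
    have hswap : ∀ j ∈ Jᶜ, e j ≤ q := fun j hj ↦ by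
      rw [Finset.mem_compl] at hj
      have hj' : j ∉ J.erase i := fun h ↦ hj (Finset.mem_of_mem_erase h)
      have h1 := hmax (insert j (J.erase i)) (Finset.mem_powersetCard.2
        ⟨Finset.subset_univ _, by
          rw [Finset.card_insert_of_notMem hj', Finset.card_erase_add_one hi, hJu]⟩)
      simp only [Finset.sum_insert hj'] at h1
      have h2 := Finset.add_sum_erase J e hi
      omega
    have h1 := Finset.sum_le_card_nsmul Jᶜ e q hswap
    have h2 := Finset.sum_add_sum_compl J e
    rw [Finset.card_compl, hJu, Fintype.card_fin, nsmul_eq_mul, Nat.cast_sub hus] at h1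
    have h3 : (s : ℤ) * q ≤ m * q := mul_le_mul_of_nonneg_right hsm hq
    linarith [min_le_left v (u : ℤ)]

/-! ### The upper bound. -/

open FinsetAtoms in
theorem dist_le_distBound {α : Type u} {M : Matroid α} {n k d r δ : ℤ} (hr : 0 < r) (hrk : r < k)
    (hδ : 2 ≤ δ)
    (hno : ¬ ∃ (α : Type u) (M : Matroid α),
      IsAtomicMatroid M ∧ IsParamMatroid M n k (singletonBound n k r δ) r δ)
    (hA : IsAtomicMatroid M) (hp : IsParamMatroid M n k d r δ) : d ≤ distBound n k r δ := by
  classical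
  by_contra! hd
  obtain ⟨s, E, F, k', ρ, hsys, hM⟩ := hA
  obtain rfl : k' = k := by rw [← hp.rank_eq, hM.ground_eq, hM.rank_ground]
  obtain ⟨f, η, rfl, hρ, hη0, h, rfl, hku⟩ := exists_finset_atoms hsys
  have hcard : ((Finset.univ.biUnion f).card : ℤ) = n := by
    rw [← hp.card_eq, hM.ground_eq, Set.ncard_coe_finset]
  have hb := locality_bounds h hη0 hρ hsys.k_pos hM hrk hδ hp.locality
  have hrj := fun j ↦ (hb j).1
  have hηj := fun j ↦ (hb j).2
  have hsmall := fun J ↦ dist_le_of_gain_lt (J := J) h hρ hM hp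
  rw [distBound_eq] at hd
  obtain ⟨ht1, ht2⟩ := ceilQuot_spec (a := k') hr
  set t := ceilQuot k' r with ht
  have ht0 : 2 ≤ t := by
    by_contra! hlt
    nlinarith
  obtain ⟨T, hT⟩ : ∃ T : ℕ, t = T := ⟨t.toNat, by omega⟩
  have hnull : ∀ J : Finset (Fin s), (J.card : ℤ) * (δ - 1) ≤ ∑ j ∈ J, η j := fun J ↦ by
    have := Finset.card_nsmul_le_sum J η (δ - 1) fun j _ ↦ hηj j
    rwa [nsmul_eq_mul] at this
  have hge : ∀ J : Finset (Fin s), J.card = T → k' ≤ gain f η J := fun J hJ ↦ by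
    by_contra! hlt
    have h1 := hsmall J hlt
    have h2 := hnull J
    rw [hJ, ← hT] at h2
    have h3 := min_le_left (δ - 1) (surplus n k' r δ)
    linarith
  have hTs : T ≤ s := by
    have h1 := gain_le_mul hrj Finset.univ
    rw [Finset.card_univ, Fintype.card_fin] at h1
    by_contra! hlt
    have h2 : (s : ℤ) ≤ t - 1 := by omega
    nlinarith
  have hns : k' + s * (δ - 1) ≤ n := by
    have h1 := hnull Finset.univ
    rw [Finset.card_univ, Fintype.card_fin] at h1
    rw [gain, hcard] at hku
    linarith
  have hnR : r + δ - 1 < n := by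
    have : (2 : ℤ) ≤ s := by omega
    nlinarith
  obtain ⟨hm, hb0, hbR, hnm, hL, hq, hv, hvm⟩ := param_facts hr hδ hnR
  -- With at most m atoms, the t-1 atoms of largest excess nullity have gain below k and already
  -- force d ≤ d_b.
  have hsN : paramM n r δ < s := by
    by_contra! hle
    have h1 := card_biUnion_le_sum f Finset.univ
    rw [hcard] at h1
    have h2 : ∑ j, ((f j).card : ℤ) ≤ s * (r + δ - 1) + ∑ j, (η j - (δ - 1)) := by
      have h3 : ∑ j, (((f j).card : ℤ) - (η j - (δ - 1))) ≤ s * (r + δ - 1) := by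
        have := Finset.sum_le_card_nsmul Finset.univ
          (fun j ↦ ((f j).card : ℤ) - (η j - (δ - 1))) (r + δ - 1) fun j _ ↦ by linarith [hrj j]
        simpa using this
      rw [Finset.sum_sub_distrib] at h3
      linarith
    obtain ⟨J, hJ, hJsum⟩ := exists_card_eq_le_sum (u := T - 1) (by omega)
      (fun j ↦ η j - (δ - 1)) (v := paramV n r δ) hq hle (by nlinarith)
    have hJ' : (J.card : ℤ) = t - 1 := by omega
    have h3 := gain_le_mul hrj J
    rw [hJ'] at h3
    have h4 := hsmall J (by linarith)
    rw [Finset.sum_sub_distrib, Finset.sum_const, nsmul_eq_mul, hJ'] at hJsum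
    have h5 : ((T - 1 : ℕ) : ℤ) = t - 1 := by omega
    rw [h5] at hJsum
    have h6 := min_le_right (δ - 1) (surplus n k' r δ)
    have h7 : surplus n k' r δ = (t - 1) * paramQ n r δ + min (paramV n r δ) (t - 1) := rfl
    linarith
  obtain ⟨f', hf', hcard'⟩ := exists_isSpread h hδ hηj hrj hge
  -- The summand ℕ supplies fresh elements without leaving the universe.
  obtain ⟨hg, hgcard⟩ := hf'.map (Function.Embedding.inl : α ↪ α ⊕ ℕ)
  obtain ⟨M', hA', hp'⟩ := hg.exists_isParamMatroid hsys.k_pos hrk hδ (n := n) (by omega) hTs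
    (by rw [← hT]; exact ht1) (by omega) (by nlinarith)
  refine hno ⟨_, M', hA', ?_⟩
  rw [singletonBound, ← ht, hT]
  exact hp'

/-! ### Tightness: matroids with disjoint atoms. -/

lemma exists_disjoint_finsets {s : ℕ} (a : Fin s → ℕ) :
    ∃ f : Fin s → Finset (ULift.{u} (ℕ × ℕ)), (∀ j, (f j).card = a j) ∧
      ∀ i j, i ≠ j → Disjoint (f i) (f j) := by
  classical
  let φ (j : Fin s) : ℕ ↪ ULift.{u} (ℕ × ℕ) :=
    ⟨fun x ↦ ⟨(j, x)⟩, fun x y hxy ↦ by simpa using hxy⟩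
  refine ⟨fun j ↦ (Finset.range (a j)).map (φ j), fun j ↦ by simp, fun i j hij ↦ ?_⟩
  rw [Finset.disjoint_left]
  intro x hxi hxj
  rw [Finset.mem_map] at hxi hxj
  obtain ⟨y, -, rfl⟩ := hxi
  obtain ⟨z, -, hz⟩ := hxj
  have h1 : (((j : ℕ), z) : ℕ × ℕ) = ((i : ℕ), y) := congrArg ULift.down hz
  exact hij (Fin.ext (congrArg Prod.fst h1).symm)

open FinsetAtoms in
/-- Disjoint atoms of ranks `ρ j` and nullities `η j`. -/
theorem exists_isParamMatroid_of_ranks {s : ℕ} (ρ η : Fin s → ℤ) {n k r δ D : ℤ} (hk : 0 < k)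
    (hrk : r < k) (hδ : 2 ≤ δ) (hρ : ∀ j, 0 < ρ j ∧ ρ j ≤ r) (hη : ∀ j, δ - 1 ≤ η j)
    (hn : ∑ j, (ρ j + η j) = n) (hku : k ≤ ∑ j, ρ j)
    (hD : ∀ J : Finset (Fin s), ∑ j ∈ J, ρ j < k → ∑ j ∈ J, η j ≤ D)
    (hD' : ∃ J : Finset (Fin s), ∑ j ∈ J, ρ j < k ∧ ∑ j ∈ J, η j = D) :
    ∃ (α : Type u) (M : Matroid α),
      IsAtomicMatroid M ∧ IsParamMatroid M n k (n - k + 1 - D) r δ := by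
  classical
  obtain ⟨f, hf, hdisj⟩ := exists_disjoint_finsets.{u} fun j ↦ (ρ j + η j).toNat
  have hcard : ∀ j, ((f j).card : ℤ) = ρ j + η j := fun j ↦ by
    rw [hf, Int.toNat_of_nonneg (by linarith [hρ j, hη j])]
  have hunion : ∀ J : Finset (Fin s), ((J.biUnion f).card : ℤ) = ∑ j ∈ J, (ρ j + η j) :=
    fun J ↦ by
      rw [Finset.card_biUnion fun i _ j _ hij ↦ hdisj i j hij]
      push_cast
      exact Finset.sum_congr rfl fun j _ ↦ hcard j
  have hgain : ∀ J, gain f η J = ∑ j ∈ J, ρ j := fun J ↦ by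
    rw [gain, hunion, Finset.sum_add_distrib]
    ring
  have h : HasPrivateParts f η := fun j J hj ↦ by
    rw [Finset.sdiff_eq_self_of_disjoint, hcard]
    · linarith [hρ j]
    · rw [Finset.disjoint_biUnion_right]
      exact fun i hi ↦ hdisj j i fun hji ↦ hj (hji ▸ hi)
  refine ⟨_, exists_isParamMatroid f h hk hrk hδ hη (fun j ↦ ?_) ?_ ?_ ?_ ?_⟩
  · rw [hcard]
    linarith [hρ j]
  · rw [hunion, hn]
  · rwa [hgain]
  · simpa only [hgain] using hD
  · simpa only [hgain] using hD'

lemma sum_ite_lt {s : ℕ} (J : Finset (Fin s)) (x : ℤ) {v : ℕ} :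
    ∑ j ∈ J, (x + if (j : ℕ) < v then 1 else 0) =
      J.card * x + ((J.filter fun j : Fin s ↦ (j : ℕ) < v).card : ℤ) := by
  rw [Finset.sum_add_distrib, Finset.sum_const, nsmul_eq_mul, Finset.sum_boole]

/-- All atoms of rank `r`, with surplus nullity spread evenly. -/
theorem exists_isParamMatroid_even {n k r δ m q v t : ℤ} (hr : 0 < r) (hrk : r < k) (hδ : 2 ≤ δ)
    (hq : 0 ≤ q) (hv : 0 ≤ v) (hvm : v < m) (hn : n = m * (r + δ - 1) + (m * q + v))
    (ht : 1 ≤ t) (htm : t ≤ m) (ht1 : (t - 1) * r < k) (ht2 : k ≤ t * r) :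
    ∃ (α : Type u) (M : Matroid α), IsAtomicMatroid M ∧
      IsParamMatroid M n k (n - k + 1 - ((t - 1) * (δ - 1) + ((t - 1) * q + min v (t - 1)))) r δ := by
  lift m to ℕ using by omega
  lift v to ℕ using hv
  refine exists_isParamMatroid_of_ranks (s := m) (fun _ ↦ r)
    (fun j ↦ δ - 1 + q + if (j : ℕ) < v then 1 else 0) (by omega) hrk hδ
    (fun _ ↦ ⟨hr, le_rfl⟩) (fun j ↦ ?_) ?_ ?_ (fun J hJ ↦ ?_) ?_
  · split_ifs <;> omega
  · rw [Finset.sum_add_distrib, sum_ite_lt, Fin.card_filter_val_lt, min_eq_right (by omega), hn]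
    simp
    ring
  · simp only [Finset.sum_const, Finset.card_univ, Fintype.card_fin, nsmul_eq_mul]
    nlinarith
  · rw [Finset.sum_const, nsmul_eq_mul] at hJ
    have hJt : (J.card : ℤ) ≤ t - 1 := by
      by_contra! hlt
      nlinarith
    have h1 : (J.filter fun j : Fin m ↦ (j : ℕ) < v).card ≤ J.card := Finset.card_filter_le _ _
    have h2 : (J.filter fun j : Fin m ↦ (j : ℕ) < v).card ≤ v := by
      refine (Finset.card_le_card (Finset.filter_subset_filter _ (Finset.subset_univ J))).trans ?_
      rw [Fin.card_filter_val_lt]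
      exact min_le_right _ _
    have h3 : ((J.filter fun j : Fin m ↦ (j : ℕ) < v).card : ℤ) ≤ min (v : ℤ) (t - 1) :=
      le_min (by omega) (by omega)
    rw [sum_ite_lt]
    have h4 : (J.card : ℤ) * (δ - 1 + q) ≤ (t - 1) * (δ - 1 + q) :=
      mul_le_mul_of_nonneg_right hJt (by omega)
    linarith
  · obtain ⟨T, hT⟩ : ∃ T : ℕ, t - 1 = T := ⟨(t - 1).toNat, by omega⟩
    have hcard : (Finset.univ.filter fun j : Fin m ↦ (j : ℕ) < T).card = T := by
      rw [Fin.card_filter_val_lt, min_eq_right (by omega)]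
    refine ⟨Finset.univ.filter fun j : Fin m ↦ (j : ℕ) < T, ?_, ?_⟩
    · rw [Finset.sum_const, nsmul_eq_mul, hcard, ← hT]
      exact ht1
    · have h1 : ((Finset.univ.filter fun j : Fin m ↦ (j : ℕ) < T).filter
          fun j : Fin m ↦ (j : ℕ) < v) = Finset.univ.filter fun j : Fin m ↦ (j : ℕ) < min v T := by
        ext j
        simp [and_comm]
      rw [sum_ite_lt, hcard, h1, Fin.card_filter_val_lt, min_eq_right (by omega), hT]
      push_cast
      ring

/-- All atoms of nullity `δ - 1` and rank `r`, except for one of rank `r - b`. -/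
theorem exists_isParamMatroid_one_deficient {n k r δ N b t : ℤ} (hrk : r < k)
    (hδ : 2 ≤ δ) (hb : 0 ≤ b) (hbr : b < r) (hn : n = N * (r + δ - 1) - b)
    (ht : 1 ≤ t) (htN : t ≤ N) (hk : k ≤ N * r - b) (ht1 : (t - 1) * r < k) (ht2 : k ≤ t * r) :
    ∃ (α : Type u) (M : Matroid α), IsAtomicMatroid M ∧
      (IsParamMatroid M n k (n - k + 1 - (t - 1) * (δ - 1)) r δ ∨
        IsParamMatroid M n k (n - k + 1 - t * (δ - 1)) r δ) := by
  lift N to ℕ using by omega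
  obtain ⟨T, hT⟩ : ∃ T : ℕ, t - 1 = T := ⟨(t - 1).toNat, by omega⟩
  set i₀ : Fin N := ⟨0, by omega⟩
  set ρ : Fin N → ℤ := fun j ↦ r - if j = i₀ then b else 0 with hρdef
  have hρ : ∀ j, 0 < ρ j ∧ ρ j ≤ r := fun j ↦ by
    simp only [hρdef]
    split_ifs <;> omega
  have hsum : ∀ J : Finset (Fin N), ∑ j ∈ J, ρ j = J.card * r - if i₀ ∈ J then b else 0 :=
    fun J ↦ by
      rw [Finset.sum_sub_distrib, Finset.sum_const, nsmul_eq_mul, Finset.sum_ite_eq']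
  have hsum1 : ∀ J : Finset (Fin N), ∑ j ∈ J, ρ j ≤ J.card * r := fun J ↦ by
    rw [hsum]
    split_ifs <;> omega
  have hsum2 : ∀ J : Finset (Fin N), J.card * r - b ≤ ∑ j ∈ J, ρ j := fun J ↦ by
    rw [hsum]
    split_ifs <;> omega
  have hη : ∀ J : Finset (Fin N), ∑ j ∈ J, (δ - 1) = J.card * (δ - 1) := fun J ↦ by
    rw [Finset.sum_const, nsmul_eq_mul]
  -- Any t+1 atoms have rank sum at least (t+1)r - b > tr ≥ k.
  have hle : ∀ J : Finset (Fin N), ∑ j ∈ J, ρ j < k → (J.card : ℤ) ≤ t := fun J hJ ↦ by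
    by_contra! hlt
    have := hsum2 J
    nlinarith
  have hreal : ∀ l : ℤ, (∀ J : Finset (Fin N), ∑ j ∈ J, ρ j < k → (J.card : ℤ) ≤ l) →
      (∃ J : Finset (Fin N), ∑ j ∈ J, ρ j < k ∧ (J.card : ℤ) = l) →
      ∃ (α : Type u) (M : Matroid α), IsAtomicMatroid M ∧
        IsParamMatroid M n k (n - k + 1 - l * (δ - 1)) r δ := by
    rintro l hl ⟨J, hJ, hJl⟩
    refine exists_isParamMatroid_of_ranks ρ (fun _ ↦ δ - 1) (by omega) hrk hδ hρ
      (fun _ ↦ le_rfl) ?_ ?_ (fun K hK ↦ ?_) ⟨J, hJ, by rw [hη, hJl]⟩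
    · rw [Finset.sum_add_distrib, hsum, hη]
      simp [hn]
      ring
    · have := hsum2 Finset.univ
      rw [Finset.card_univ, Fintype.card_fin] at this
      linarith
    · rw [hη]
      exact mul_le_mul_of_nonneg_right (hl K hK) (by omega)
  by_cases hex : ∃ J : Finset (Fin N), ∑ j ∈ J, ρ j < k ∧ (J.card : ℤ) = t
  · obtain ⟨α, M, h1, h2⟩ := hreal t hle hex
    exact ⟨α, M, h1, Or.inr h2⟩
  · push Not at hex
    obtain ⟨J, -, hJ⟩ := Finset.exists_subset_card_eq
      (s := (Finset.univ : Finset (Fin N))) (n := T)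
      (by rw [Finset.card_univ, Fintype.card_fin]; omega)
    obtain ⟨α, M, h1, h2⟩ := hreal (t - 1)
      (fun J hJ ↦ by have := hle J hJ; have := hex J hJ; omega)
      ⟨J, by have := hsum1 J; rw [hJ, ← hT] at this; omega, by omega⟩
    exact ⟨α, M, h1, Or.inl h2⟩

theorem exists_isParamMatroid_distBound {n k r δ : ℤ} (hr : 0 < r) (hrk : r < k) (hδ : 2 ≤ δ)
    (hno : ¬ ∃ (α : Type u) (M : Matroid α),
      IsAtomicMatroid M ∧ IsParamMatroid M n k (singletonBound n k r δ) r δ)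
    (hkn : k ≤ n - ceilQuot k r * (δ - 1)) :
    ∃ (α : Type u) (M : Matroid α),
      IsAtomicMatroid M ∧ IsParamMatroid M n k (distBound n k r δ) r δ := by
  rw [distBound_eq]
  unfold singletonBound at hno
  obtain ⟨ht1, ht2⟩ := ceilQuot_spec (a := k) hr
  have hX : surplus n k r δ = (ceilQuot k r - 1) * paramQ n r δ +
    min (paramV n r δ) (ceilQuot k r - 1) := rfl
  set t := ceilQuot k r
  have ht0 : 2 ≤ t := by
    by_contra! hlt
    nlinarith
  have hnR : r + δ - 1 < n := by nlinarith
  obtain ⟨hm, hb0, hbR, hnm, hL, hq, hv, hvm⟩ := param_facts hr hδ hnR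
  set m := paramM n r δ
  set b := paramB n r δ
  set q := paramQ n r δ
  set v := paramV n r δ
  set X := surplus n k r δ
  have htN : t ≤ m + 1 := by
    by_contra! hlt
    nlinarith
  by_cases hcase : δ - 1 ≤ X ∧ b < r
  · obtain ⟨hXle, hbr⟩ := hcase
    have hkN : k ≤ (m + 1) * r - b := by
      rcases htN.lt_or_eq with hlt | heq
      · have : t * r ≤ m * r := mul_le_mul_of_nonneg_right (by omega) hr.le
        linarith
      · rw [heq] at hkn
        linarith
    obtain ⟨α, M, hA, hM | hM⟩ := exists_isParamMatroid_one_deficient.{u} (n := n) (N := m + 1) hrk hδ hb0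
      hbr (by linarith) (by omega) htN hkN ht1 ht2
    -- The hypothesis excludes distance n-k+1-(t-1)(δ-1), leaving n-k+1-t(δ-1).
    · exact absurd ⟨α, M, hA, hM⟩ hno
    · refine ⟨α, M, hA, ?_⟩
      rw [min_eq_left hXle]
      convert hM using 2
      ring
  -- If t = m+1, then mr < k ≤ (m+1)r - b gives b < r, and X = mq+v = r+δ-1-b ≥ δ-1, which is the
  -- previous case.
  · have htm : t ≤ m := by
      by_contra! hlt
      have htm : t = m + 1 := by omega
      rw [htm] at hX ht1 hkn
      have hbr : b < r := by linarith
      rw [min_eq_left (by omega)] at hX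
      refine hcase ⟨?_, hbr⟩
      linarith
    -- If X > δ-1, then b ≥ r in this case, so X ≤ mq+v = r+δ-1-b ≤ δ-1, a contradiction.
    have hmin : min (δ - 1) X = X := by
      refine min_eq_right ?_
      by_contra! hlt
      have hbr : r ≤ b := by
        by_contra! hbr
        exact hcase ⟨hlt.le, hbr⟩
      have h1 := min_le_left v (t - 1)
      have h2 : (t - 1) * q ≤ m * q := mul_le_mul_of_nonneg_right (by omega) hq
      linarith
    rw [hmin, hX]
    exact exists_isParamMatroid_even hr hrk hδ hq hv hvm (by linarith) (by omega) htm ht1 ht2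

theorem mainTheorem3 (n k r δ : ℤ) (hr : 0 < r) (hrk : r < k) (hδ : 2 ≤ δ)
    (hno : ¬ ∃ (α : Type u) (M : Matroid α),
      IsAtomicMatroid M ∧ IsParamMatroid M n k (singletonBound n k r δ) r δ) :
    (∀ (α : Type u) (M : Matroid α) (d : ℤ),
      IsAtomicMatroid M → IsParamMatroid M n k d r δ → d ≤ distBound n k r δ) ∧
    (k ≤ n - ceilQuot k r * (δ - 1) →
      ∃ (α : Type u) (M : Matroid α),
        IsAtomicMatroid M ∧ IsParamMatroid M n k (distBound n k r δ) r δ) :=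
  ⟨fun _ _ _ hA hp ↦ dist_le_distBound hr hrk hδ hno hA hp,
    exists_isParamMatroid_distBound hr hrk hδ hno⟩
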